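/- For a connected smooth Riemannian manifold $(M^n,g)$ without boundary, let $d$ be the Riemannian distance, $B(x,r)$ the open metric balls, $\mathrm{vol}$ the Riemannian volume measure, $\nabla$ the Levi-Civita connection, $\mathrm{Rm}$ the Riemann curvature tensor, and $|\cdot|$ the pointwise norm of tensors induced by $g$. Given $\Lambda\in\mathbb R$ and $k\in\mathbb N$, say that $(M^n,g)$ is $(\Lambda,k)$-regular if for all $x\in M$, $r>0$ and $\varepsilon\in(0,1)$ such that $$\sup_{B(x,\varepsilon r)}|\mathrm{Rm}|\le \frac1{r^2}$$ one has, for all $j=1,\dots,k$, $$\sup_{B(x,\frac{\varepsilon}{2} r)}|\nabla^j\mathrm{Rm}|\le\frac{\Lambda}{(\varepsilon r)^j r^2}.$$ **Corollary 3.4.** For every real $\Lambda\ge 1$ and every dimension $n$ there is a constant $\epsilon(\Lambda,n)>0$, depending only on $\Lambda$ and $n$, with the following property. Let $(M^n,g)$ be a complete $(\Lambda,1)$-regular Riemannian manifold and let $v>0$. Assume that i) $\mathrm{vol}\,B(x,r)\ge v\,r^n$ for all $x\in M$ and all $r>0$; ii) $\displaystyle\int_M|\mathrm{Rm}|^{n/2}\,d\mathrm{vol}\le\epsilon(\Lambda,n)\,v$.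 Then $\mathrm{Rm}=0$. -/

import Mathlib

open Bundle Manifold MeasureTheory
open scoped ContDiff ENNReal

noncomputable section

namespace RiemannianGeometry

section Connection

variable {n : ℕ} {M : Type*} [TopologicalSpace M]
  [ChartedSpace (EuclideanSpace ℝ (Fin n)) M]

/-- Vector fields on an `n`-manifold `M` (sections of `TM`, without any regularity). -/
abbrev VField (n : ℕ) (M : Type*) [TopologicalSpace M]
    [ChartedSpace (EuclideanSpace ℝ (Fin n)) M] : Type _ :=
  (x : M) → TangentSpace (𝓡 n) x

/-- The extension of a tangent vector `v ∈ T_x M` to a vector field near `x`, with constant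
coefficients in the preferred chart at `x`. -/
def extendVec [IsManifold (𝓡 n) 1 M] {x : M} (v : TangentSpace (𝓡 n) x) : VField n M :=
  FiberBundle.extend (EuclideanSpace ℝ (Fin n)) v

variable [RiemannianBundle (fun x : M ↦ TangentSpace (𝓡 n) x)]

/-- The function `g(X, Y)`. -/
def innerField (X Y : VField n M) : M → ℝ := fun x ↦ inner ℝ (X x) (Y x)

/-- The right-hand side of the Koszul formula
`X g(Y,Z) + Y g(X,Z) - Z g(X,Y) + g([X,Y],Z) - g([X,Z],Y) - g([Y,Z],X)`,
which equals `2 g(∇_X Y, Z)`. -/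
def koszul (X Y Z : VField n M) (x : M) : ℝ :=
  mvfderiv (𝓡 n) (innerField Y Z) x (X x)
    + mvfderiv (𝓡 n) (innerField X Z) x (Y x)
    - mvfderiv (𝓡 n) (innerField X Y) x (Z x)
    + inner ℝ (VectorField.mlieBracket (𝓡 n) X Y x) (Z x)
    - inner ℝ (VectorField.mlieBracket (𝓡 n) X Z x) (Y x)
    - inner ℝ (VectorField.mlieBracket (𝓡 n) Y Z x) (X x)

instance (x : M) : FiniteDimensional ℝ (TangentSpace (𝓡 n) x) :=
  inferInstanceAs (FiniteDimensional ℝ (EuclideanSpace ℝ (Fin n)))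

/-- An orthonormal basis of `(T_x M, g_x)`. -/
def onb (n : ℕ) {M : Type*} [TopologicalSpace M] [ChartedSpace (EuclideanSpace ℝ (Fin n)) M]
    [RiemannianBundle (fun x : M ↦ TangentSpace (𝓡 n) x)] (x : M) :
    OrthonormalBasis (Fin (Module.finrank ℝ (TangentSpace (𝓡 n) x))) ℝ (TangentSpace (𝓡 n) x) :=
  stdOrthonormalBasis ℝ (TangentSpace (𝓡 n) x)

variable [IsManifold (𝓡 n) 1 M]

/-- The Levi-Civita connection `∇_X Y`: the vector whose inner product with every `e` of an
orthonormal basis of `T_x M` is given by the Koszul formula. -/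
def nabla (X Y : VField n M) : VField n M := fun x ↦
  ∑ i, ((1 / 2 : ℝ) * koszul X Y (extendVec (onb n x i)) x) • onb n x i

/-- The Riemann curvature `R(X,Y)Z = ∇_X ∇_Y Z - ∇_Y ∇_X Z - ∇_{[X,Y]} Z`, as an operation on
triples `(X, Y, Z)` of vector fields. -/
def curvature (V : Fin 3 → VField n M) : VField n M :=
  nabla (V 0) (nabla (V 1) (V 2)) - nabla (V 1) (nabla (V 0) (V 2))
    - nabla (VectorField.mlieBracket (𝓡 n) (V 0) (V 1)) (V 2)

/-- The covariant derivative of a `TM`-valued `m`-tensor `T`, the latter acting on vector fields: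
`(∇T)(X, Y_1, …, Y_m) = ∇_X (T(Y_1, …, Y_m)) - ∑ i, T(Y_1, …, ∇_X Y_i, …, Y_m)`. -/
def covDeriv {m : ℕ} (T : (Fin m → VField n M) → VField n M) :
    (Fin (m + 1) → VField n M) → VField n M := fun V ↦
  nabla (V 0) (T (Fin.tail V))
    - ∑ i : Fin m, T (Function.update (Fin.tail V) i (nabla (V 0) (Fin.tail V i)))

/-- The iterated covariant derivative `∇^j Rm` of the Riemann curvature tensor. -/
def nablaRm : (j : ℕ) → (Fin (3 + j) → VField n M) → VField n M
  | 0 => curvature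
  | j + 1 => covDeriv (nablaRm j)

/-- The value at `x` of a tensor on given tangent vectors at `x`. -/
def tensorAt {m : ℕ} (T : (Fin m → VField n M) → VField n M) (x : M)
    (v : Fin m → TangentSpace (𝓡 n) x) : TangentSpace (𝓡 n) x :=
  T (fun i ↦ extendVec (v i)) x

/-- The pointwise norm `|T|(x)` of a `TM`-valued `m`-tensor `T`:
`|T|² = ∑ |T(e_{i_1}, …, e_{i_m})|²` over an orthonormal basis of `T_x M`. -/
def tensorNorm {m : ℕ} (T : (Fin m → VField n M) → VField n M) (x : M) : ℝ :=
  Real.sqrt (∑ s : Fin m → Fin (Module.finrank ℝ (TangentSpace (𝓡 n) x)),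
    ‖tensorAt T x (fun i ↦ onb n x (s i))‖ ^ 2)

end Connection

section Regular

/-- `(M^n, g)` is `(Λ, k)`-regular: for all `x ∈ M`, `r > 0` and `ε ∈ (0, 1)`, if
`|Rm| ≤ 1 / r²` on `B(x, ε r)` then `|∇^j Rm| ≤ Λ / ((ε r)^j r²)` on `B(x, ε r / 2)` for
`j = 1, …, k`. -/
def IsRegularMetric (n : ℕ) (M : Type*) [MetricSpace M]
    [ChartedSpace (EuclideanSpace ℝ (Fin n)) M] [IsManifold (𝓡 n) 1 M]
    [RiemannianBundle (fun x : M ↦ TangentSpace (𝓡 n) x)] (L : ℝ) (k : ℕ) : Prop :=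
  ∀ (x : M) (r ε : ℝ), 0 < r → 0 < ε → ε < 1 →
    (∀ y ∈ Metric.ball x (ε * r), tensorNorm (n := n) (nablaRm 0) y ≤ 1 / r ^ 2) →
    ∀ j : ℕ, 1 ≤ j → j ≤ k → ∀ y ∈ Metric.ball x (ε / 2 * r),
      tensorNorm (n := n) (nablaRm j) y ≤ L / ((ε * r) ^ j * r ^ 2)

end Regular

section Volume

variable {n : ℕ} {M : Type*} [TopologicalSpace M]
  [ChartedSpace (EuclideanSpace ℝ (Fin n)) M]

/-- The coordinate vector field `∂_i` of the preferred chart at `x`, at the point of `M` with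
coordinates `z`. -/
def coordVec (x : M) (z : EuclideanSpace ℝ (Fin n)) (i : Fin n) :
    TangentSpace (𝓡 n) ((chartAt (EuclideanSpace ℝ (Fin n)) x).symm z) :=
  mfderiv (𝓡 n) (𝓡 n) (chartAt (EuclideanSpace ℝ (Fin n)) x).symm z
    (EuclideanSpace.single i (1 : ℝ) : EuclideanSpace ℝ (Fin n))

variable [RiemannianBundle (fun x : M ↦ TangentSpace (𝓡 n) x)]

/-- The volume density `√det(g_{ij})` in the preferred chart at `x`. -/
def volDensity (x : M) (z : EuclideanSpace ℝ (Fin n)) : ℝ :=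
  Real.sqrt (Matrix.det (Matrix.of fun i j : Fin n ↦
    (inner ℝ (coordVec x z i) (coordVec x z j) : ℝ)))

/-- The measure `√det(g_{ij}) dz` on the domain of the preferred chart at `x`, as a measure on
`M` that is zero off that domain. -/
def chartVolume (n : ℕ) {M : Type*} [TopologicalSpace M] [MeasurableSpace M]
    [ChartedSpace (EuclideanSpace ℝ (Fin n)) M]
    [RiemannianBundle (fun x : M ↦ TangentSpace (𝓡 n) x)] (x : M) : Measure M :=
  Measure.map (chartAt (EuclideanSpace ℝ (Fin n)) x).symm
    (((volume : Measure (EuclideanSpace ℝ (Fin n))).restrict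
      (chartAt (EuclideanSpace ℝ (Fin n)) x).target).withDensity
        fun z ↦ ENNReal.ofReal (volDensity x z))

/-- The Riemannian volume measure. The measures `√det(g_{ij}) dz` of the charts agree on the
overlaps, and their supremum in the lattice of measures is the measure that they glue to. -/
def riemannianVolume (n : ℕ) (M : Type*) [TopologicalSpace M] [MeasurableSpace M]
    [ChartedSpace (EuclideanSpace ℝ (Fin n)) M]
    [RiemannianBundle (fun x : M ↦ TangentSpace (𝓡 n) x)] : Measure M :=
  ⨆ x : M, chartVolume n x

end Volume

end RiemannianGeometry

end

/-! The proof is a scale-invariant contradiction. Suppose `Rm` is nonzero somewhere. By point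
picking (`exists_almost_max`, where completeness enters) there is a point `x` with `|Rm|(x) = s² >
0` and `|Rm| ≤ 4s²` on the ball of radius `1/s` around it. Regularity turns this into `|∇Rm| ≤ 16 L
s³` on a smaller ball, so Kato's inequality bounds the differential of `|Rm|²` by `128 L s⁵`.
Integrating along short paths gives `|Rm| ≥ (s/2)²` on a ball of radius `1/(256 L s)`
(`exists_ball_curvature_ge`). By the volume lower bound this ball contributes at least `(s/2)^n · v
· (1/(256 L s))^n = v / (512 L)^n` to the integral of `|Rm|^(n/2)`. The scale `s` has cancelled, so
an energy below this threshold forces `Rm = 0`.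

Most of the work is the tensor calculus behind Kato's inequality. `nabla`, `curvature` and
`covDeriv` act on arbitrary vector fields, and pointwise norms use an unspecified orthonormal basis
in each tangent space. It must be shown that these operations are tensorial (`isTensor_curvature`,
`IsTensor.covDeriv`), that the norm can be computed in a smooth orthonormal frame
(`IsTensor.tensorNorm_sq_eq`), and that the connection is metric (`mvfderiv_innerField`). Then
`d|T|² = 2⟨∇T, T⟩`, and Cauchy-Schwarz gives `IsTensor.abs_mvfderiv_tensorNorm_sq_le`. -/

noncomputable section

namespace RiemannianGeometry

open Filter Topology

set_option linter.unusedSectionVars false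

/-! ### Germs of smooth fields and functions -/

section SmoothNear

variable {n : ℕ} {M : Type*} [TopologicalSpace M]
  [ChartedSpace (EuclideanSpace ℝ (Fin n)) M] [IsManifold (𝓡 n) ∞ M]

/-- The vector field `X` is `C^k` at `x`. -/
abbrev ContDiffFieldAt (k : WithTop ℕ∞) (X : VField n M) (x : M) : Prop :=
  ContMDiffAt (𝓡 n) ((𝓡 n).prod 𝓘(ℝ, EuclideanSpace ℝ (Fin n))) k
    (fun y ↦ (⟨y, X y⟩ : TangentBundle (𝓡 n) M)) x

/-- The vector field `X` is differentiable at `x`. -/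
abbrev DiffFieldAt (X : VField n M) (x : M) : Prop :=
  MDifferentiableAt (𝓡 n) ((𝓡 n).prod 𝓘(ℝ, EuclideanSpace ℝ (Fin n)))
    (fun y ↦ (⟨y, X y⟩ : TangentBundle (𝓡 n) M)) x

/-- The vector field `X` is smooth in a neighbourhood of `x`. -/
def SmoothNear (X : VField n M) (x : M) : Prop :=
  ∀ᶠ y in 𝓝 x, ContDiffFieldAt ∞ X y

/-- The function `f` is smooth in a neighbourhood of `x`. -/
def SmoothFunNear (n : ℕ) {M : Type*} [TopologicalSpace M]
    [ChartedSpace (EuclideanSpace ℝ (Fin n)) M] (f : M → ℝ) (x : M) : Prop :=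
  ∀ᶠ y in 𝓝 x, ContMDiffAt (𝓡 n) 𝓘(ℝ) ∞ f y

variable {X Y : VField n M} {f g : M → ℝ} {x : M}

lemma SmoothNear.contDiffFieldAt (h : SmoothNear X x) : ContDiffFieldAt ∞ X x := h.self_of_nhds

lemma SmoothNear.diffFieldAt (h : SmoothNear X x) : DiffFieldAt X x :=
  h.contDiffFieldAt.mdifferentiableAt (by simp)

/-- This openness is the reason for working with `SmoothNear`: being `C^∞` at a single point allows
the neighbourhood to shrink with the order of differentiability, whereas iterated derivatives need
smoothness on one fixed neighbourhood. -/
lemma SmoothNear.eventually (h : SmoothNear X x) : ∀ᶠ y in 𝓝 x, SmoothNear X y :=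
  eventually_eventually_nhds.2 h

lemma SmoothNear.congr (h : SmoothNear X x) (hXY : ∀ᶠ y in 𝓝 x, Y y = X y) :
    SmoothNear Y x := by
  filter_upwards [h, eventually_eventually_nhds.2 hXY] with y hy hy'
  refine hy.congr_of_eventuallyEq ?_
  filter_upwards [hy'] with z hz
  simp [hz]

lemma SmoothFunNear.contMDiffAt (h : SmoothFunNear n f x) : ContMDiffAt (𝓡 n) 𝓘(ℝ) ∞ f x :=
  h.self_of_nhds

lemma SmoothFunNear.mdifferentiableAt (h : SmoothFunNear n f x) :
    MDifferentiableAt (𝓡 n) 𝓘(ℝ) f x :=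
  h.contMDiffAt.mdifferentiableAt (by simp)

lemma SmoothFunNear.eventually (h : SmoothFunNear n f x) : ∀ᶠ y in 𝓝 x, SmoothFunNear n f y :=
  eventually_eventually_nhds.2 h

lemma SmoothFunNear.congr (h : SmoothFunNear n f x) (hfg : ∀ᶠ y in 𝓝 x, g y = f y) :
    SmoothFunNear n g x := by
  filter_upwards [h, eventually_eventually_nhds.2 hfg] with y hy hy'
  exact hy.congr_of_eventuallyEq hy'

lemma smoothFunNear_const (c : ℝ) : SmoothFunNear n (fun _ : M ↦ c) x :=
  Eventually.of_forall fun _ ↦ contMDiffAt_const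

lemma SmoothFunNear.add (hf : SmoothFunNear n f x) (hg : SmoothFunNear n g x) :
    SmoothFunNear n (fun y ↦ f y + g y) x := by
  filter_upwards [hf, hg] with y h1 h2 using h1.add h2

lemma SmoothFunNear.mul (hf : SmoothFunNear n f x) (hg : SmoothFunNear n g x) :
    SmoothFunNear n (fun y ↦ f y * g y) x := by
  filter_upwards [hf, hg] with y h1 h2
  exact h1.mul h2

lemma SmoothFunNear.sub (hf : SmoothFunNear n f x) (hg : SmoothFunNear n g x) :
    SmoothFunNear n (fun y ↦ f y - g y) x := by
  filter_upwards [hf, hg] with y h1 h2 using h1.sub h2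

lemma SmoothFunNear.sum {ι : Type*} (s : Finset ι) {f : ι → M → ℝ}
    (hf : ∀ i ∈ s, SmoothFunNear n (f i) x) : SmoothFunNear n (fun y ↦ ∑ i ∈ s, f i y) x := by
  classical
  induction s using Finset.induction_on with
  | empty => simpa using smoothFunNear_const (n := n) 0
  | insert a s ha ih =>
    simp only [Finset.sum_insert ha]
    exact (hf a (by simp)).add (ih fun i hi ↦ hf i (by simp [hi]))

lemma SmoothNear.add (hX : SmoothNear X x) (hY : SmoothNear Y x) : SmoothNear (X + Y) x := by
  filter_upwards [hX, hY] with y h1 h2 using ContMDiffAt.add_section h1 h2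

lemma SmoothNear.smul (hf : SmoothFunNear n f x) (hX : SmoothNear X x) : SmoothNear (f • X) x := by
  filter_upwards [hf, hX] with y h1 h2 using ContMDiffAt.smul_section h1 h2

lemma SmoothNear.sub (hX : SmoothNear X x) (hY : SmoothNear Y x) : SmoothNear (X - Y) x := by
  filter_upwards [hX, hY] with y h1 h2 using ContMDiffAt.sub_section h1 h2

lemma SmoothNear.sum {ι : Type*} (s : Finset ι) {X : ι → VField n M}
    (hX : ∀ i ∈ s, SmoothNear (X i) x) : SmoothNear (∑ i ∈ s, X i) x := by
  have : ∀ᶠ y in 𝓝 x, ∀ i ∈ s, ContDiffFieldAt ∞ (X i) y :=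
    (Finset.eventually_all s).2 hX
  filter_upwards [this] with y hy
  have h := ContMDiffAt.sum_section (F := EuclideanSpace ℝ (Fin n))
    (V := fun x : M ↦ TangentSpace (𝓡 n) x) hy
  refine h.congr_of_eventuallyEq (Eventually.of_forall fun z ↦ ?_)
  simp

lemma smoothNear_extendVec (v : TangentSpace (𝓡 n) x) : SmoothNear (extendVec v) x := by
  obtain ⟨s, hs, h⟩ := FiberBundle.exists_contMDiffOn_extend (k := ∞) (𝓡 n)
    (EuclideanSpace ℝ (Fin n)) (V := fun x : M ↦ TangentSpace (𝓡 n) x) v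
  filter_upwards [eventually_mem_nhds_iff.2 hs] with y hy
  exact h.contMDiffAt hy

@[simp]
lemma extendVec_self (v : TangentSpace (𝓡 n) x) : extendVec v x = v :=
  FiberBundle.extend_apply_self (EuclideanSpace ℝ (Fin n))
    (E := fun x : M ↦ TangentSpace (𝓡 n) x) v

lemma SmoothNear.mlieBracket (hX : SmoothNear X x) (hY : SmoothNear Y x) :
    SmoothNear (VectorField.mlieBracket (𝓡 n) X Y) x := by
  filter_upwards [hX, hY] with y h1 h2
  have : IsManifold (𝓡 n) (((⊤ : ℕ∞) : WithTop ℕ∞) + 1) M := by simpa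
  have : IsManifold (𝓡 n) (minSmoothness ℝ 2) M := by
    rw [minSmoothness_of_isRCLikeNormedField]; infer_instance
  exact ContMDiffAt.mlieBracket_vectorField (m := ⊤) (n := ⊤) (I := 𝓡 n) h1 h2 (by simp)

/-- On an open set where both are smooth, `X f` is the fibre component of the tangent map of `f`
composed with the section `X`. -/
lemma SmoothFunNear.mvfderiv (hf : SmoothFunNear n f x) (hX : SmoothNear X x) :
    SmoothFunNear n (fun y ↦ mvfderiv (𝓡 n) f y (X y)) x := by
  obtain ⟨U, hU, hUo, hxU⟩ := eventually_nhds_iff.1 (hf.and hX)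
  have hfU : ContMDiffOn (𝓡 n) 𝓘(ℝ) ∞ f U := fun y hy ↦ (hU y hy).1.contMDiffWithinAt
  have hT := hfU.contMDiffOn_tangentMapWithin (m := ∞) (by simp) hUo.uniqueMDiffOn
  filter_upwards [hUo.mem_nhds hxU] with y hy
  have hX' : ContMDiffOn (𝓡 n) ((𝓡 n).prod 𝓘(ℝ, EuclideanSpace ℝ (Fin n))) ∞
    (fun y ↦ (⟨y, X y⟩ : TangentBundle (𝓡 n) M)) U := fun z hz ↦ (hU z hz).2.contMDiffWithinAt
  have h := (hT.comp hX' (fun z hz ↦ hz)).contMDiffAt (hUo.mem_nhds hy)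
  have h2 := (contMDiff_snd_tangentBundle_modelSpace ℝ 𝓘(ℝ, ℝ) (n := ∞)).contMDiffAt.comp y h
  refine h2.congr_of_eventuallyEq ?_
  filter_upwards [hUo.mem_nhds hy] with z hz
  change mfderiv (𝓡 n) 𝓘(ℝ) f z (X z) = mfderivWithin (𝓡 n) 𝓘(ℝ) f U z (X z)
  rw [mfderivWithin_of_isOpen hUo hz]

end SmoothNear

/-! ### Smooth orthonormal frames -/

section Metric

variable {n : ℕ} {M : Type*} [TopologicalSpace M]
  [ChartedSpace (EuclideanSpace ℝ (Fin n)) M] [IsManifold (𝓡 n) ∞ M]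
  [RiemannianBundle (fun x : M ↦ TangentSpace (𝓡 n) x)]
  [IsContMDiffRiemannianBundle (𝓡 n) ∞ (EuclideanSpace ℝ (Fin n))
    (fun x : M ↦ TangentSpace (𝓡 n) x)]
  {X Y : VField n M} {x : M}

lemma SmoothNear.innerField (hX : SmoothNear X x) (hY : SmoothNear Y x) :
    SmoothFunNear n (innerField X Y) x := by
  filter_upwards [hX, hY] with y h1 h2
  exact ContMDiffAt.inner_bundle h1 h2

lemma DiffFieldAt.innerField (hX : DiffFieldAt X x) (hY : DiffFieldAt Y x) :
    MDifferentiableAt (𝓡 n) 𝓘(ℝ) (innerField X Y) x := by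
  have : IsContMDiffRiemannianBundle (𝓡 n) 1 (EuclideanSpace ℝ (Fin n))
      (fun x : M ↦ TangentSpace (𝓡 n) x) := IsContMDiffRiemannianBundle.of_le (n := ∞) (by simp)
  exact MDifferentiableAt.inner_bundle hX hY

lemma SmoothFunNear.comp_of_pos {f : M → ℝ} (hf : SmoothFunNear n f x) (h0 : 0 < f x)
    {φ : ℝ → ℝ} (hφ : ∀ t, 0 < t → ContDiffAt ℝ ∞ φ t) :
    SmoothFunNear n (fun y ↦ φ (f y)) x := by
  filter_upwards [hf, hf.contMDiffAt.continuousAt.eventually (lt_mem_nhds h0)] with y hy h0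
  exact (hφ _ h0).contMDiffAt.comp y hy

/-- The Gram-Schmidt process preserves smoothness as long as it does not degenerate. -/
lemma smoothNear_gramSchmidt {k : ℕ} {A : Fin k → VField n M} (hA : ∀ i, SmoothNear (A i) x)
    (h0 : ∀ i, InnerProductSpace.gramSchmidt ℝ (fun i ↦ A i x) i ≠ 0) (i : Fin k) :
    SmoothNear (fun y ↦ InnerProductSpace.gramSchmidt ℝ (fun i ↦ A i y) i) x := by
  induction i using WellFoundedLT.induction with
  | ind i ih =>
    set G : Fin k → VField n M := fun j y ↦ InnerProductSpace.gramSchmidt ℝ (fun i ↦ A i y) j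
      with hG
    have key : SmoothNear (A i - ∑ j ∈ Finset.Iio i,
        (fun y ↦ innerField (G j) (A i) y * (innerField (G j) (G j) y)⁻¹) • G j) x := by
      refine (hA i).sub (SmoothNear.sum _ fun j hj ↦ ?_)
      have hj' := ih j (Finset.mem_Iio.1 hj)
      refine SmoothNear.smul ((hj'.innerField (hA i)).mul ?_) hj'
      refine (hj'.innerField hj').comp_of_pos ?_ (φ := fun t ↦ t⁻¹)
        fun t ht ↦ contDiffAt_inv ℝ ht.ne'
      exact real_inner_self_pos.2 (h0 j)
    refine key.congr (Eventually.of_forall fun y ↦ ?_)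
    simp only [Pi.sub_apply, Finset.sum_apply, Pi.smul_apply']
    rw [InnerProductSpace.gramSchmidt_def]
    congr 1
    refine Finset.sum_congr rfl fun j _ ↦ ?_
    rw [Submodule.starProjection_singleton]
    simp [innerField, hG, div_eq_mul_inv]

/-- The fields `E i` form a smooth orthonormal frame of the tangent bundle near `x`. -/
structure IsOrthoFrameNear {ι : Type*} [Fintype ι] (E : ι → VField n M) (x : M) : Prop where
  smooth : ∀ i, SmoothNear (E i) x
  basis : ∀ᶠ y in 𝓝 x, ∃ b : OrthonormalBasis ι ℝ (TangentSpace (𝓡 n) y), ∀ i, E i y = b i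

/-- Gram-Schmidt is applied to the local extensions of the basis vectors and the result is
normalized. At `x` the extensions are already orthonormal, so the process fixes them; nearby it
stays nondegenerate by continuity. -/
lemma exists_isOrthoFrameNear {k : ℕ} (b : OrthonormalBasis (Fin k) ℝ (TangentSpace (𝓡 n) x)) :
    ∃ E : Fin k → VField n M, IsOrthoFrameNear E x ∧ ∀ i, E i x = b i := by
  set A : Fin k → VField n M := fun i ↦ extendVec (b i)
  have hA : ∀ i, SmoothNear (A i) x := fun i ↦ smoothNear_extendVec _
  have hAx : (fun i ↦ A i x) = b := by ext1 i; simp [A]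
  set G : Fin k → VField n M := fun j y ↦ InnerProductSpace.gramSchmidt ℝ (fun i ↦ A i y) j
    with hG
  have hGx : ∀ i, G i x = b i := fun i ↦ by
    simp only [hG, hAx]
    rw [InnerProductSpace.gramSchmidt_of_orthogonal]
    exact fun i j hij ↦ b.orthonormal.2 hij
  have hGs : ∀ i, SmoothNear (G i) x := by
    refine smoothNear_gramSchmidt hA fun i ↦ ?_
    have := hGx i
    simp only [hG] at this
    rw [this]
    exact b.orthonormal.ne_zero i
  have hne : ∀ i, 0 < innerField (G i) (G i) x := fun i ↦ by
    simp [innerField, hGx]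
  refine ⟨fun i ↦ (fun y ↦ (Real.sqrt (innerField (G i) (G i) y))⁻¹) • G i, ⟨fun i ↦ ?_, ?_⟩,
    fun i ↦ ?_⟩
  · refine SmoothNear.smul ?_ (hGs i)
    refine ((hGs i).innerField (hGs i)).comp_of_pos (hne i)
      (φ := fun t ↦ (Real.sqrt t)⁻¹) fun t ht ↦ ?_
    exact (Real.contDiffAt_sqrt ht.ne').inv (Real.sqrt_pos.2 ht).ne'
  · have : ∀ᶠ y in 𝓝 x, ∀ i, innerField (G i) (G i) y ≠ 0 := by
      refine eventually_all.2 fun i ↦ ?_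
      exact ((hGs i).innerField (hGs i)).contMDiffAt.continuousAt.eventually_ne (hne i).ne'
    filter_upwards [this] with y hy
    have hon : Orthonormal ℝ fun i ↦ (Real.sqrt (innerField (G i) (G i) y))⁻¹ • G i y := by
      refine ⟨fun i ↦ ?_, fun i j hij ↦ ?_⟩
      · have : G i y ≠ 0 := by simpa [innerField] using hy i
        simp [innerField, norm_smul, this]
      · have : inner ℝ (G i y) (G j y) = 0 :=
          InnerProductSpace.gramSchmidt_orthogonal ℝ _ hij
        simp [inner_smul_left, inner_smul_right, this]
    have hcard : Fintype.card (Fin k) = Module.finrank ℝ (TangentSpace (𝓡 n) y) := by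
      have h1 : Module.finrank ℝ (TangentSpace (𝓡 n) y) = Module.finrank ℝ (TangentSpace (𝓡 n) x) :=
        rfl
      rw [h1, Module.finrank_eq_card_basis b.toBasis]
    have hspan := (hon.linearIndependent.span_eq_top_of_card_eq_finrank' hcard).ge
    exact ⟨OrthonormalBasis.mk hon hspan, fun i ↦ by simp⟩
  · simp [innerField, hGx]

lemma IsOrthoFrameNear.self {ι : Type*} [Fintype ι] {E : ι → VField n M}
    (h : IsOrthoFrameNear E x) :
    ∃ b : OrthonormalBasis ι ℝ (TangentSpace (𝓡 n) x), ∀ i, E i x = b i :=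
  h.basis.self_of_nhds

lemma IsOrthoFrameNear.eventually {ι : Type*} [Fintype ι] {E : ι → VField n M}
    (h : IsOrthoFrameNear E x) : ∀ᶠ y in 𝓝 x, IsOrthoFrameNear E y := by
  filter_upwards [eventually_all.2 fun i ↦ (h.smooth i).eventually,
    eventually_eventually_nhds.2 h.basis] with y h1 h2 using ⟨h1, h2⟩

end Metric

/-! ### The Koszul formula and the Levi-Civita connection -/

section LeviCivita

variable {n : ℕ} {M : Type*} [TopologicalSpace M]
  [ChartedSpace (EuclideanSpace ℝ (Fin n)) M] [IsManifold (𝓡 n) ∞ M]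
  [RiemannianBundle (fun x : M ↦ TangentSpace (𝓡 n) x)]
  [IsContMDiffRiemannianBundle (𝓡 n) ∞ (EuclideanSpace ℝ (Fin n))
    (fun x : M ↦ TangentSpace (𝓡 n) x)]
  {X X' Y Y' Z Z' : VField n M} {f g : M → ℝ} {x : M}

lemma innerField_comm (X Y : VField n M) : innerField X Y = innerField Y X := by
  ext y; exact real_inner_comm _ _

lemma innerField_add_right (X Y Z : VField n M) :
    innerField X (Y + Z) = innerField X Y + innerField X Z := by
  ext y; exact inner_add_right _ _ _

lemma innerField_add_left (X Y Z : VField n M) :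
    innerField (X + Y) Z = innerField X Z + innerField Y Z := by
  ext y; exact inner_add_left _ _ _

lemma innerField_smul_right (f : M → ℝ) (X Y : VField n M) :
    innerField X (f • Y) = f * innerField X Y := by
  ext y; exact real_inner_smul_right _ _ _

lemma innerField_smul_left (f : M → ℝ) (X Y : VField n M) :
    innerField (f • X) Y = f * innerField X Y := by
  ext y; exact real_inner_smul_left _ _ _

lemma innerField_apply (X Y : VField n M) (y : M) : innerField X Y y = inner ℝ (X y) (Y y) := rfl

lemma mvfderiv_mul_apply (hf : MDifferentiableAt (𝓡 n) 𝓘(ℝ) f x)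
    (hg : MDifferentiableAt (𝓡 n) 𝓘(ℝ) g x) (v : TangentSpace (𝓡 n) x) :
    mvfderiv (𝓡 n) (f * g) x v = f x * mvfderiv (𝓡 n) g x v + g x * mvfderiv (𝓡 n) f x v := by
  rw [mvfderiv_mul hf hg]; rfl

lemma mvfderiv_add_apply (hf : MDifferentiableAt (𝓡 n) 𝓘(ℝ) f x)
    (hg : MDifferentiableAt (𝓡 n) 𝓘(ℝ) g x) (v : TangentSpace (𝓡 n) x) :
    mvfderiv (𝓡 n) (f + g) x v = mvfderiv (𝓡 n) f x v + mvfderiv (𝓡 n) g x v := by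
  rw [mvfderiv_add hf hg]; rfl

lemma mvfderiv_congr (h : ∀ᶠ y in 𝓝 x, f y = g y) : mvfderiv (𝓡 n) f x = mvfderiv (𝓡 n) g x := by
  have hx := h.self_of_nhds
  ext v
  change mfderiv (𝓡 n) 𝓘(ℝ) f x v = mfderiv (𝓡 n) 𝓘(ℝ) g x v
  rw [EventuallyEq.mfderiv_eq h]
  rfl

lemma koszul_add_right (hX : DiffFieldAt X x) (hY : DiffFieldAt Y x) (hZ : DiffFieldAt Z x)
    (hZ' : DiffFieldAt Z' x) : koszul X Y (Z + Z') x = koszul X Y Z x + koszul X Y Z' x := by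
  simp only [koszul, innerField_add_right, Pi.add_apply]
  rw [mvfderiv_add_apply (hY.innerField hZ) (hY.innerField hZ'),
    mvfderiv_add_apply (hX.innerField hZ) (hX.innerField hZ'),
    VectorField.mlieBracket_add_right hZ hZ', VectorField.mlieBracket_add_right hZ hZ']
  simp only [inner_add_left, inner_add_right, map_add]
  ring

lemma koszul_smul_right (hX : DiffFieldAt X x) (hY : DiffFieldAt Y x) (hZ : DiffFieldAt Z x)
    (hf : MDifferentiableAt (𝓡 n) 𝓘(ℝ) f x) : koszul X Y (f • Z) x = f x * koszul X Y Z x := by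
  simp only [koszul, innerField_smul_right, Pi.smul_apply']
  rw [mvfderiv_mul_apply hf (hY.innerField hZ), mvfderiv_mul_apply hf (hX.innerField hZ),
    VectorField.mlieBracket_smul_right hf hZ, VectorField.mlieBracket_smul_right hf hZ]
  simp only [inner_add_left, inner_smul_left, inner_smul_right, map_smul, innerField_apply,
    RCLike.conj_to_real, smul_eq_mul]
  rw [real_inner_comm (Y x) (Z x), real_inner_comm (X x) (Z x)]
  ring

lemma koszul_add_left (hX : DiffFieldAt X x) (hX' : DiffFieldAt X' x) (hY : DiffFieldAt Y x)
    (hZ : DiffFieldAt Z x) : koszul (X + X') Y Z x = koszul X Y Z x + koszul X' Y Z x := by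
  simp only [koszul, innerField_add_left, Pi.add_apply]
  rw [mvfderiv_add_apply (hX.innerField hZ) (hX'.innerField hZ),
    mvfderiv_add_apply (hX.innerField hY) (hX'.innerField hY),
    VectorField.mlieBracket_add_left hX hX', VectorField.mlieBracket_add_left hX hX']
  simp only [inner_add_left, inner_add_right, map_add]
  ring

/-- The derivatives of `f` produced by the metric terms cancel those produced by the brackets. The
same happens in the last slot; in the middle slot the two terms in `X f` add up instead, which is
the Leibniz rule for `nabla`. -/
lemma koszul_smul_left (hX : DiffFieldAt X x) (hY : DiffFieldAt Y x) (hZ : DiffFieldAt Z x)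
    (hf : MDifferentiableAt (𝓡 n) 𝓘(ℝ) f x) : koszul (f • X) Y Z x = f x * koszul X Y Z x := by
  simp only [koszul, innerField_smul_left, Pi.smul_apply']
  rw [mvfderiv_mul_apply hf (hX.innerField hZ), mvfderiv_mul_apply hf (hX.innerField hY),
    VectorField.mlieBracket_smul_left hf hX, VectorField.mlieBracket_smul_left hf hX]
  simp only [inner_add_left, inner_smul_left, inner_smul_right, map_smul, innerField_apply,
    RCLike.conj_to_real, smul_eq_mul, map_neg]
  ring

lemma koszul_add_middle (hX : DiffFieldAt X x) (hY : DiffFieldAt Y x) (hY' : DiffFieldAt Y' x)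
    (hZ : DiffFieldAt Z x) : koszul X (Y + Y') Z x = koszul X Y Z x + koszul X Y' Z x := by
  simp only [koszul, innerField_add_left, innerField_add_right, Pi.add_apply]
  rw [mvfderiv_add_apply (hY.innerField hZ) (hY'.innerField hZ),
    mvfderiv_add_apply (hX.innerField hY) (hX.innerField hY'),
    VectorField.mlieBracket_add_left hY hY', VectorField.mlieBracket_add_right hY hY']
  simp only [inner_add_left, inner_add_right, map_add]
  ring

lemma koszul_smul_middle (hX : DiffFieldAt X x) (hY : DiffFieldAt Y x) (hZ : DiffFieldAt Z x)
    (hf : MDifferentiableAt (𝓡 n) 𝓘(ℝ) f x) :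
    koszul X (f • Y) Z x
      = f x * koszul X Y Z x + 2 * (mvfderiv (𝓡 n) f x (X x) * inner ℝ (Y x) (Z x)) := by
  simp only [koszul, innerField_smul_left, innerField_smul_right, Pi.smul_apply']
  rw [mvfderiv_mul_apply hf (hY.innerField hZ), mvfderiv_mul_apply hf (hX.innerField hY),
    VectorField.mlieBracket_smul_right hf hY, VectorField.mlieBracket_smul_left hf hY]
  simp only [inner_add_left, inner_smul_left, inner_smul_right, map_smul, innerField_apply,
    RCLike.conj_to_real, smul_eq_mul, map_neg]
  rw [real_inner_comm (Y x) (X x)]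
  ring

/-- This is metric compatibility: apart from `X g(Y,Z)`, the terms of the Koszul expression are
antisymmetric in `Y` and `Z`. -/
lemma koszul_add_koszul_swap (X Y Z : VField n M) (x : M) :
    koszul X Y Z x + koszul X Z Y x = 2 * mvfderiv (𝓡 n) (innerField Y Z) x (X x) := by
  simp only [koszul]
  rw [innerField_comm Z Y, VectorField.mlieBracket_swap_apply (V := Z) (W := Y), inner_neg_left]
  ring

lemma koszul_congr (hX : ∀ᶠ y in 𝓝 x, X y = X' y) (hY : ∀ᶠ y in 𝓝 x, Y y = Y' y)
    (hZ : ∀ᶠ y in 𝓝 x, Z y = Z' y) : koszul X Y Z x = koszul X' Y' Z' x := by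
  have hXY : ∀ᶠ y in 𝓝 x, innerField X Y y = innerField X' Y' y := by
    filter_upwards [hX, hY] with y h1 h2; simp [innerField, h1, h2]
  have hXZ : ∀ᶠ y in 𝓝 x, innerField X Z y = innerField X' Z' y := by
    filter_upwards [hX, hZ] with y h1 h2; simp [innerField, h1, h2]
  have hYZ : ∀ᶠ y in 𝓝 x, innerField Y Z y = innerField Y' Z' y := by
    filter_upwards [hY, hZ] with y h1 h2; simp [innerField, h1, h2]
  simp only [koszul]
  rw [mvfderiv_congr hXY, mvfderiv_congr hXZ, mvfderiv_congr hYZ,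
    EventuallyEq.mlieBracket_vectorField_eq hX hY, EventuallyEq.mlieBracket_vectorField_eq hX hZ,
    EventuallyEq.mlieBracket_vectorField_eq hY hZ, hX.self_of_nhds, hY.self_of_nhds,
    hZ.self_of_nhds]

lemma koszul_smooth (hX : SmoothNear X x) (hY : SmoothNear Y x) (hZ : SmoothNear Z x) :
    SmoothFunNear n (koszul X Y Z) x :=
  ((((((hY.innerField hZ).mvfderiv hX).add ((hX.innerField hZ).mvfderiv hY)).sub
    ((hX.innerField hY).mvfderiv hZ)).add ((hX.mlieBracket hY).innerField hZ)).sub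
    ((hX.mlieBracket hZ).innerField hY)).sub ((hY.mlieBracket hZ).innerField hX)

lemma tensorialAt_koszul (hX : DiffFieldAt X x) (hY : DiffFieldAt Y x) :
    TensorialAt (𝓡 n) (EuclideanSpace ℝ (Fin n)) (fun Z : VField n M ↦ koszul X Y Z x) x where
  smul hf hσ := koszul_smul_right hX hY hσ hf
  add hσ hσ' := koszul_add_right hX hY hσ hσ'

/-- `nabla` tests only against constant-coefficient extensions of `onb`. Tensoriality of `koszul` in
its last slot frees the test field, and all properties of the connection are derived from this form.
-/
lemma inner_nabla (hX : DiffFieldAt X x) (hY : DiffFieldAt Y x) (hZ : DiffFieldAt Z x) :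
    inner ℝ (nabla X Y x) (Z x) = 1 / 2 * koszul X Y Z x := by
  have hT := tensorialAt_koszul hX hY
  set L := TensorialAt.mkHom _ _ hT
  have hL : ∀ v, koszul X Y (extendVec v) x = L v := fun v ↦ rfl
  have hZ' : koszul X Y Z x = L (Z x) := (hT.mkHom_apply hZ).symm
  rw [hZ', ← (onb n x).sum_repr' (Z x), map_sum]
  simp only [nabla, hL, sum_inner, inner_smul_left, map_smul, smul_eq_mul,
    RCLike.conj_to_real, (onb n x).sum_repr', Finset.mul_sum]
  refine Finset.sum_congr rfl fun i _ ↦ ?_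
  ring

lemma eq_of_inner_extendVec {v w : TangentSpace (𝓡 n) x}
    (h : ∀ u : TangentSpace (𝓡 n) x, inner ℝ v (extendVec u x) = inner ℝ w (extendVec u x)) :
    v = w :=
  ext_inner_right ℝ fun u ↦ by simpa using h u

lemma diffFieldAt_extendVec (v : TangentSpace (𝓡 n) x) : DiffFieldAt (extendVec v) x :=
  (smoothNear_extendVec v).diffFieldAt

lemma DiffFieldAt.add (hX : DiffFieldAt X x) (hY : DiffFieldAt Y x) : DiffFieldAt (X + Y) x :=
  mdifferentiableAt_add_section hX hY

lemma DiffFieldAt.smul (hf : MDifferentiableAt (𝓡 n) 𝓘(ℝ) f x) (hX : DiffFieldAt X x) :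
    DiffFieldAt (f • X) x :=
  MDifferentiableAt.smul_section hf hX

lemma nabla_add_left (hX : DiffFieldAt X x) (hX' : DiffFieldAt X' x) (hY : DiffFieldAt Y x) :
    nabla (X + X') Y x = nabla X Y x + nabla X' Y x := by
  refine eq_of_inner_extendVec fun u ↦ ?_
  have hu := diffFieldAt_extendVec u
  rw [inner_add_left, inner_nabla (hX.add hX') hY hu, inner_nabla hX hY hu, inner_nabla hX' hY hu,
    koszul_add_left hX hX' hY hu]
  ring

lemma nabla_smul_left (hf : MDifferentiableAt (𝓡 n) 𝓘(ℝ) f x) (hX : DiffFieldAt X x)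
    (hY : DiffFieldAt Y x) : nabla (f • X) Y x = f x • nabla X Y x := by
  refine eq_of_inner_extendVec fun u ↦ ?_
  have hu := diffFieldAt_extendVec u
  rw [real_inner_smul_left, inner_nabla (hX.smul hf) hY hu, inner_nabla hX hY hu,
    koszul_smul_left hX hY hu hf]
  ring

lemma nabla_add_right (hX : DiffFieldAt X x) (hY : DiffFieldAt Y x) (hY' : DiffFieldAt Y' x) :
    nabla X (Y + Y') x = nabla X Y x + nabla X Y' x := by
  refine eq_of_inner_extendVec fun u ↦ ?_
  have hu := diffFieldAt_extendVec u
  rw [inner_add_left, inner_nabla hX (hY.add hY') hu, inner_nabla hX hY hu, inner_nabla hX hY' hu,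
    koszul_add_middle hX hY hY' hu]
  ring

lemma nabla_smul_right (hX : DiffFieldAt X x) (hf : MDifferentiableAt (𝓡 n) 𝓘(ℝ) f x)
    (hY : DiffFieldAt Y x) :
    nabla X (f • Y) x = f x • nabla X Y x + mvfderiv (𝓡 n) f x (X x) • Y x := by
  refine eq_of_inner_extendVec fun u ↦ ?_
  have hu := diffFieldAt_extendVec u
  rw [inner_add_left, real_inner_smul_left, real_inner_smul_left, inner_nabla hX (hY.smul hf) hu,
    inner_nabla hX hY hu, koszul_smul_middle hX hY hu hf]
  ring

lemma mvfderiv_innerField (hX : DiffFieldAt X x) (hY : DiffFieldAt Y x) (hZ : DiffFieldAt Z x) :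
    mvfderiv (𝓡 n) (innerField Y Z) x (X x)
      = inner ℝ (nabla X Y x) (Z x) + inner ℝ (Y x) (nabla X Z x) := by
  rw [real_inner_comm (nabla X Z x), inner_nabla hX hY hZ, inner_nabla hX hZ hY, ← mul_add,
    koszul_add_koszul_swap]
  ring

lemma nabla_congr (hX : ∀ᶠ y in 𝓝 x, X y = X' y) (hY : ∀ᶠ y in 𝓝 x, Y y = Y' y) :
    nabla X Y x = nabla X' Y' x := by
  simp only [nabla]
  refine Finset.sum_congr rfl fun i _ ↦ ?_
  rw [koszul_congr hX hY (Eventually.of_forall fun _ ↦ rfl)]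

/-- The bases `onb` at different points are unrelated, so the defining sum shows no smoothness. It
is rewritten in a smooth orthonormal frame, whose coefficients are Koszul expressions. -/
lemma SmoothNear.nabla (hX : SmoothNear X x) (hY : SmoothNear Y x) :
    SmoothNear (nabla X Y) x := by
  obtain ⟨E, hE, -⟩ := exists_isOrthoFrameNear (onb n x)
  have h : SmoothNear (∑ i, (fun y ↦ (1 / 2 : ℝ) * koszul X Y (E i) y) • E i) x :=
    SmoothNear.sum _ fun i _ ↦ SmoothNear.smul
      ((smoothFunNear_const _).mul (koszul_smooth hX hY (hE.smooth i))) (hE.smooth i)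
  refine h.congr ?_
  filter_upwards [hX.eventually, hY.eventually, hE.eventually] with y hX hY hE
  obtain ⟨b, hb⟩ := hE.self
  simp only [Finset.sum_apply, Pi.smul_apply']
  rw [← b.sum_repr' (RiemannianGeometry.nabla X Y y)]
  refine Finset.sum_congr rfl fun i _ ↦ ?_
  rw [← hb, real_inner_comm,
    inner_nabla hX.diffFieldAt hY.diffFieldAt (hE.smooth i).diffFieldAt]

end LeviCivita

/-! ### Tensoriality of the curvature -/

section Tensor

variable {n : ℕ} {M : Type*} [TopologicalSpace M]
  [ChartedSpace (EuclideanSpace ℝ (Fin n)) M] [IsManifold (𝓡 n) ∞ M]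
  [RiemannianBundle (fun x : M ↦ TangentSpace (𝓡 n) x)]
  [IsContMDiffRiemannianBundle (𝓡 n) ∞ (EuclideanSpace ℝ (Fin n))
    (fun x : M ↦ TangentSpace (𝓡 n) x)]
  {X X' Y Y' Z Z' : VField n M} {f g : M → ℝ} {x : M}

/-- The derivative `X f` of a function along a vector field. -/
def derivAlong (X : VField n M) (f : M → ℝ) : M → ℝ := fun y ↦ mvfderiv (𝓡 n) f y (X y)

lemma SmoothFunNear.derivAlong (hf : SmoothFunNear n f x) (hX : SmoothNear X x) :
    SmoothFunNear n (derivAlong X f) x :=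
  SmoothFunNear.mvfderiv hf hX

lemma SmoothFunNear.neg (hf : SmoothFunNear n f x) : SmoothFunNear n (-f) x := by
  filter_upwards [hf] with y h1 using h1.neg

lemma lie_smul_right (hf : SmoothFunNear n f x) (hY : SmoothNear Y x) :
    VectorField.mlieBracket (𝓡 n) X (f • Y) x
      = derivAlong X f x • Y x + f x • VectorField.mlieBracket (𝓡 n) X Y x :=
  VectorField.mlieBracket_smul_right hf.mdifferentiableAt hY.diffFieldAt

lemma lie_congr_right (hY : ∀ᶠ y in 𝓝 x, Y y = Y' y) :
    VectorField.mlieBracket (𝓡 n) X Y x = VectorField.mlieBracket (𝓡 n) X Y' x :=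
  EventuallyEq.mlieBracket_vectorField_eq EventuallyEq.rfl hY

lemma lie_lie_smul_right (hf : SmoothFunNear n f x) (hY : SmoothNear Y x)
    (hZ : SmoothNear Z x) :
    VectorField.mlieBracket (𝓡 n) X (VectorField.mlieBracket (𝓡 n) Y (f • Z)) x
      = derivAlong X (derivAlong Y f) x • Z x
        + derivAlong Y f x • VectorField.mlieBracket (𝓡 n) X Z x
        + derivAlong X f x • VectorField.mlieBracket (𝓡 n) Y Z x
        + f x • VectorField.mlieBracket (𝓡 n) X (VectorField.mlieBracket (𝓡 n) Y Z) x := by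
  have h : ∀ᶠ y in 𝓝 x, VectorField.mlieBracket (𝓡 n) Y (f • Z) y
      = (derivAlong Y f • Z + f • VectorField.mlieBracket (𝓡 n) Y Z) y := by
    filter_upwards [hf.eventually, hZ.eventually] with y h1 h2 using lie_smul_right h1 h2
  rw [lie_congr_right h, VectorField.mlieBracket_add_right
    (SmoothNear.smul (hf.derivAlong hY) hZ).diffFieldAt
    (SmoothNear.smul hf (hY.mlieBracket hZ)).diffFieldAt,
    lie_smul_right (hf.derivAlong hY) hZ, lie_smul_right hf (hY.mlieBracket hZ)]
  abel

/-- `[X, Y] f = X (Y f) - Y (X f)`, tested on a vector field; a consequence of the Jacobi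
identity. -/
lemma derivAlong_commutator (hf : SmoothFunNear n f x) (hX : SmoothNear X x) (hY : SmoothNear Y x)
    (hZ : SmoothNear Z x) :
    derivAlong (VectorField.mlieBracket (𝓡 n) X Y) f x • Z x
      = derivAlong X (derivAlong Y f) x • Z x - derivAlong Y (derivAlong X f) x • Z x := by
  have hM : IsManifold (𝓡 n) (minSmoothness ℝ 3) M := by
    rw [minSmoothness_of_isRCLikeNormedField]; infer_instance
  have h2 : ∀ {W : VField n M}, SmoothNear W x → ContDiffFieldAt (minSmoothness ℝ 2) W x :=
    fun {W} hW ↦ by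
      rw [minSmoothness_of_isRCLikeNormedField]
      exact hW.contDiffFieldAt.of_le ENat.LEInfty.out
  have J := VectorField.leibniz_identity_mlieBracket_apply (I := 𝓡 n) (h2 hX) (h2 hY)
    (h2 (SmoothNear.smul hf hZ))
  have J0 := VectorField.leibniz_identity_mlieBracket_apply (I := 𝓡 n) (h2 hX) (h2 hY) (h2 hZ)
  -- Expand the Jacobi identity for `f • Z` and remove `f` times the one for `Z`. The mixed terms
  -- `(X f) [Y, Z]` and `(Y f) [X, Z]` cancel.
  rw [lie_lie_smul_right hf hY hZ, lie_lie_smul_right hf hX hZ,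
    lie_smul_right hf hZ, J0, smul_add] at J
  have J' := sub_eq_zero.2 J
  rw [← sub_eq_zero, ← neg_eq_zero, ← J']
  abel

lemma nabla_congr_right (h : ∀ᶠ y in 𝓝 x, Y y = Y' y) : nabla X Y x = nabla X Y' x :=
  nabla_congr (Eventually.of_forall fun _ ↦ rfl) h

lemma nabla_congr_left (h : ∀ᶠ y in 𝓝 x, X y = X' y) : nabla X Y x = nabla X' Y x :=
  nabla_congr h (Eventually.of_forall fun _ ↦ rfl)

/-- The curvature `R(X, Y) Z`. -/
def curv (X Y Z : VField n M) : VField n M :=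
  nabla X (nabla Y Z) - nabla Y (nabla X Z) - nabla (VectorField.mlieBracket (𝓡 n) X Y) Z

lemma SmoothNear.curv (hX : SmoothNear X x) (hY : SmoothNear Y x) (hZ : SmoothNear Z x) :
    SmoothNear (curv X Y Z) x :=
  ((hX.nabla (hY.nabla hZ)).sub (hY.nabla (hX.nabla hZ))).sub ((hX.mlieBracket hY).nabla hZ)

lemma curv_congr (hX : ∀ᶠ y in 𝓝 x, X y = X' y) (hY : ∀ᶠ y in 𝓝 x, Y y = Y' y)
    (hZ : ∀ᶠ y in 𝓝 x, Z y = Z' y) : curv X Y Z x = curv X' Y' Z' x := by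
  have hX' := eventually_eventually_nhds.2 hX
  have hY' := eventually_eventually_nhds.2 hY
  have hZ' := eventually_eventually_nhds.2 hZ
  simp only [curv, Pi.sub_apply]
  rw [nabla_congr hX (Y' := nabla Y' Z'), nabla_congr hY (Y' := nabla X' Z'),
    nabla_congr (EventuallyEq.mlieBracket_vectorField hX hY) hZ]
  · filter_upwards [hX', hZ'] with y h1 h2 using nabla_congr h1 h2
  · filter_upwards [hY', hZ'] with y h1 h2 using nabla_congr h1 h2

/-- Reduces linearity in the second slot to linearity in the first. -/
lemma curv_swap (hX : SmoothNear X x) (hY : SmoothNear Y x) (hZ : SmoothNear Z x) :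
    curv X Y Z x = -curv Y X Z x := by
  have h : VectorField.mlieBracket (𝓡 n) Y X
      = (fun _ : M ↦ (-1 : ℝ)) • VectorField.mlieBracket (𝓡 n) X Y := by
    rw [VectorField.mlieBracket_swap]
    ext1 y
    simp
  simp only [curv, Pi.sub_apply, h]
  rw [nabla_smul_left (smoothFunNear_const _).mdifferentiableAt (hX.mlieBracket hY).diffFieldAt
    hZ.diffFieldAt]
  simp only [neg_smul, one_smul]
  abel

lemma curv_add_left (hX : SmoothNear X x) (hX' : SmoothNear X' x) (hY : SmoothNear Y x)
    (hZ : SmoothNear Z x) : curv (X + X') Y Z x = curv X Y Z x + curv X' Y Z x := by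
  have h1 : ∀ᶠ y in 𝓝 x, nabla (X + X') Z y = (nabla X Z + nabla X' Z) y := by
    filter_upwards [hX.eventually, hX'.eventually, hZ.eventually] with y h1 h2 h3
    exact nabla_add_left h1.diffFieldAt h2.diffFieldAt h3.diffFieldAt
  have h2 : ∀ᶠ y in 𝓝 x, VectorField.mlieBracket (𝓡 n) (X + X') Y y
      = (VectorField.mlieBracket (𝓡 n) X Y + VectorField.mlieBracket (𝓡 n) X' Y) y := by
    filter_upwards [hX.eventually, hX'.eventually] with y h1 h2
    exact VectorField.mlieBracket_add_left h1.diffFieldAt h2.diffFieldAt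
  simp only [curv, Pi.sub_apply]
  rw [nabla_congr_right h1, nabla_congr_left h2,
    nabla_add_left hX.diffFieldAt hX'.diffFieldAt (hY.nabla hZ).diffFieldAt,
    nabla_add_right hY.diffFieldAt (hX.nabla hZ).diffFieldAt (hX'.nabla hZ).diffFieldAt,
    nabla_add_left (hX.mlieBracket hY).diffFieldAt (hX'.mlieBracket hY).diffFieldAt
      hZ.diffFieldAt]
  abel

lemma curv_smul_left (hf : SmoothFunNear n f x) (hX : SmoothNear X x) (hY : SmoothNear Y x)
    (hZ : SmoothNear Z x) : curv (f • X) Y Z x = f x • curv X Y Z x := by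
  have h1 : ∀ᶠ y in 𝓝 x, nabla (f • X) Z y = (f • nabla X Z) y := by
    filter_upwards [hf.eventually, hX.eventually, hZ.eventually] with y h1 h2 h3
    exact nabla_smul_left h1.mdifferentiableAt h2.diffFieldAt h3.diffFieldAt
  have h2 : ∀ᶠ y in 𝓝 x, VectorField.mlieBracket (𝓡 n) (f • X) Y y
      = ((-derivAlong Y f) • X + f • VectorField.mlieBracket (𝓡 n) X Y) y := by
    filter_upwards [hf.eventually, hX.eventually] with y h1 h2
    exact VectorField.mlieBracket_smul_left h1.mdifferentiableAt h2.diffFieldAt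
  have hd := (hf.derivAlong hY).neg
  simp only [curv, Pi.sub_apply]
  rw [nabla_congr_right h1, nabla_congr_left h2,
    nabla_smul_left hf.mdifferentiableAt hX.diffFieldAt (hY.nabla hZ).diffFieldAt,
    nabla_smul_right hY.diffFieldAt hf.mdifferentiableAt (hX.nabla hZ).diffFieldAt,
    nabla_add_left (SmoothNear.smul hd hX).diffFieldAt
      (SmoothNear.smul hf (hX.mlieBracket hY)).diffFieldAt hZ.diffFieldAt,
    nabla_smul_left hd.mdifferentiableAt hX.diffFieldAt hZ.diffFieldAt,
    nabla_smul_left hf.mdifferentiableAt (hX.mlieBracket hY).diffFieldAt hZ.diffFieldAt]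
  simp only [Pi.neg_apply, derivAlong, smul_sub, neg_smul]
  abel

lemma curv_add_right (hX : SmoothNear X x) (hY : SmoothNear Y x)
    (hZ : SmoothNear Z x) (hZ' : SmoothNear Z' x) :
    curv X Y (Z + Z') x = curv X Y Z x + curv X Y Z' x := by
  have h : ∀ {W : VField n M}, SmoothNear W x →
      ∀ᶠ y in 𝓝 x, nabla W (Z + Z') y = (nabla W Z + nabla W Z') y := by
    intro W hW
    filter_upwards [hW.eventually, hZ.eventually, hZ'.eventually] with y h1 h2 h3
    exact nabla_add_right h1.diffFieldAt h2.diffFieldAt h3.diffFieldAt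
  simp only [curv, Pi.sub_apply]
  rw [nabla_congr_right (h hX), nabla_congr_right (h hY),
    nabla_add_right hX.diffFieldAt (hY.nabla hZ).diffFieldAt (hY.nabla hZ').diffFieldAt,
    nabla_add_right hY.diffFieldAt (hX.nabla hZ).diffFieldAt (hX.nabla hZ').diffFieldAt,
    nabla_add_right (hX.mlieBracket hY).diffFieldAt hZ.diffFieldAt hZ'.diffFieldAt]
  abel

lemma nabla_nabla_smul_right (hf : SmoothFunNear n f x) (hX : SmoothNear X x)
    (hY : SmoothNear Y x) (hZ : SmoothNear Z x) :
    nabla X (nabla Y (f • Z)) x = f x • nabla X (nabla Y Z) x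
      + derivAlong X f x • nabla Y Z x + derivAlong Y f x • nabla X Z x
      + derivAlong X (derivAlong Y f) x • Z x := by
  have h : ∀ᶠ y in 𝓝 x, nabla Y (f • Z) y = (f • nabla Y Z + derivAlong Y f • Z) y := by
    filter_upwards [hf.eventually, hY.eventually, hZ.eventually] with y h1 h2 h3
    exact nabla_smul_right h2.diffFieldAt h1.mdifferentiableAt h3.diffFieldAt
  have hd := hf.derivAlong hY
  rw [nabla_congr_right h, nabla_add_right hX.diffFieldAt
      (SmoothNear.smul hf (hY.nabla hZ)).diffFieldAt (SmoothNear.smul hd hZ).diffFieldAt,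
    nabla_smul_right hX.diffFieldAt hf.mdifferentiableAt (hY.nabla hZ).diffFieldAt,
    nabla_smul_right hX.diffFieldAt hd.mdifferentiableAt hZ.diffFieldAt]
  simp only [derivAlong]
  abel

/-- The first-order terms are symmetric in `X` and `Y` and cancel; the second-order ones leave
`X(Yf) - Y(Xf) - [X,Y]f`, which vanishes by `derivAlong_commutator`. -/
lemma curv_smul_right (hf : SmoothFunNear n f x) (hX : SmoothNear X x) (hY : SmoothNear Y x)
    (hZ : SmoothNear Z x) : curv X Y (f • Z) x = f x • curv X Y Z x := by
  have h := derivAlong_commutator hf hX hY hZ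
  simp only [curv, Pi.sub_apply]
  rw [nabla_nabla_smul_right hf hX hY hZ, nabla_nabla_smul_right hf hY hX hZ,
    nabla_smul_right (hX.mlieBracket hY).diffFieldAt hf.mdifferentiableAt hZ.diffFieldAt]
  change _ - (_ + derivAlong (VectorField.mlieBracket (𝓡 n) X Y) f x • Z x) = _
  rw [h, smul_sub, smul_sub]
  abel

/-- A `TM`-valued operation on `m` vector fields that is local, preserves smoothness, and is
multilinear over the smooth functions. -/
structure IsTensor {m : ℕ} (T : (Fin m → VField n M) → VField n M) : Prop where
  congr : ∀ {x : M} {V W : Fin m → VField n M},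
    (∀ i, ∀ᶠ y in 𝓝 x, V i y = W i y) → T V x = T W x
  smooth : ∀ {x : M} {V : Fin m → VField n M},
    (∀ i, SmoothNear (V i) x) → SmoothNear (T V) x
  add : ∀ {x : M} {V : Fin m → VField n M} (i : Fin m) {X Y : VField n M},
    (∀ i, SmoothNear (V i) x) → SmoothNear X x → SmoothNear Y x →
    T (Function.update V i (X + Y)) x = T (Function.update V i X) x + T (Function.update V i Y) x
  smul : ∀ {x : M} {V : Fin m → VField n M} (i : Fin m) {f : M → ℝ} {X : VField n M},
    (∀ i, SmoothNear (V i) x) → SmoothFunNear n f x → SmoothNear X x →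
    T (Function.update V i (f • X)) x = f x • T (Function.update V i X) x

lemma isTensor_curvature : IsTensor (curvature : (Fin 3 → VField n M) → VField n M) where
  congr h := curv_congr (h 0) (h 1) (h 2)
  smooth h := (h 0).curv (h 1) (h 2)
  add {x V} i {X Y} hV hX hY := by
    fin_cases i
    · exact curv_add_left hX hY (hV 1) (hV 2)
    · change curv (V 0) (X + Y) (V 2) x = curv (V 0) X (V 2) x + curv (V 0) Y (V 2) x
      rw [curv_swap (hV 0) (hX.add hY) (hV 2), curv_swap (hV 0) hX (hV 2),
        curv_swap (hV 0) hY (hV 2), curv_add_left hX hY (hV 0) (hV 2), neg_add]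
    · exact curv_add_right (hV 0) (hV 1) hX hY
  smul {x V} i {f X} hV hf hX := by
    fin_cases i
    · exact curv_smul_left hf hX (hV 1) (hV 2)
    · change curv (V 0) (f • X) (V 2) x = f x • curv (V 0) X (V 2) x
      rw [curv_swap (hV 0) (SmoothNear.smul hf hX) (hV 2), curv_swap (hV 0) hX (hV 2),
        curv_smul_left hf hX (hV 0) (hV 2), smul_neg]
    · exact curv_smul_right hf (hV 0) (hV 1) hX

lemma smoothNear_update {m : ℕ} {V : Fin m → VField n M} (hV : ∀ i, SmoothNear (V i) x)
    (i : Fin m) (hX : SmoothNear X x) (j : Fin m) : SmoothNear (Function.update V i X j) x := by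
  rcases eq_or_ne j i with rfl | h
  · simpa
  · simpa [h] using hV j

/-! ### Tensoriality of the covariant derivative -/

section covDeriv

variable {m : ℕ} {T : (Fin m → VField n M) → VField n M} (hT : IsTensor T)
  {W : Fin m → VField n M}

include hT

lemma IsTensor.update_congr (i : Fin m) (h : ∀ᶠ y in 𝓝 x, X y = Y y) :
    T (Function.update W i X) x = T (Function.update W i Y) x := by
  refine hT.congr fun j ↦ ?_
  rcases eq_or_ne j i with rfl | hj
  · simpa
  · simp [hj]

lemma IsTensor.smooth_update (hW : ∀ i, SmoothNear (W i) x) (i : Fin m) (hX : SmoothNear X x) :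
    SmoothNear (T (Function.update W i X)) x :=
  hT.smooth (smoothNear_update hW i hX)

lemma IsTensor.update_nabla_add_left (hW : ∀ i, SmoothNear (W i) x) (i : Fin m)
    (hX : SmoothNear X x) (hY : SmoothNear Y x) (hZ : SmoothNear Z x) :
    T (Function.update W i (nabla (X + Y) Z)) x
      = T (Function.update W i (nabla X Z)) x + T (Function.update W i (nabla Y Z)) x := by
  rw [← hT.add i hW (hX.nabla hZ) (hY.nabla hZ)]
  refine hT.update_congr i ?_
  filter_upwards [hX.eventually, hY.eventually, hZ.eventually] with y h1 h2 h3
  exact nabla_add_left h1.diffFieldAt h2.diffFieldAt h3.diffFieldAt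

lemma IsTensor.update_nabla_smul_left (hW : ∀ i, SmoothNear (W i) x) (i : Fin m)
    (hf : SmoothFunNear n f x) (hX : SmoothNear X x) (hZ : SmoothNear Z x) :
    T (Function.update W i (nabla (f • X) Z)) x
      = f x • T (Function.update W i (nabla X Z)) x := by
  rw [← hT.smul i hW hf (hX.nabla hZ)]
  refine hT.update_congr i ?_
  filter_upwards [hf.eventually, hX.eventually, hZ.eventually] with y h1 h2 h3
  exact nabla_smul_left h1.mdifferentiableAt h2.diffFieldAt h3.diffFieldAt

lemma IsTensor.update_nabla_add_right (hW : ∀ i, SmoothNear (W i) x) (i : Fin m)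
    (hX : SmoothNear X x) (hY : SmoothNear Y x) (hZ : SmoothNear Z x) :
    T (Function.update W i (nabla Z (X + Y))) x
      = T (Function.update W i (nabla Z X)) x + T (Function.update W i (nabla Z Y)) x := by
  rw [← hT.add i hW (hZ.nabla hX) (hZ.nabla hY)]
  refine hT.update_congr i ?_
  filter_upwards [hX.eventually, hY.eventually, hZ.eventually] with y h1 h2 h3
  exact nabla_add_right h3.diffFieldAt h1.diffFieldAt h2.diffFieldAt

lemma IsTensor.update_nabla_smul_right (hW : ∀ i, SmoothNear (W i) x) (i : Fin m)
    (hf : SmoothFunNear n f x) (hX : SmoothNear X x) (hZ : SmoothNear Z x) :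
    T (Function.update W i (nabla Z (f • X))) x
      = f x • T (Function.update W i (nabla Z X)) x
        + derivAlong Z f x • T (Function.update W i X) x := by
  have hd := hf.derivAlong hZ
  rw [← hT.smul i hW hf (hZ.nabla hX), ← hT.smul i hW hd hX,
    ← hT.add i hW (SmoothNear.smul hf (hZ.nabla hX)) (SmoothNear.smul hd hX)]
  refine hT.update_congr i ?_
  filter_upwards [hf.eventually, hX.eventually, hZ.eventually] with y h1 h2 h3
  exact nabla_smul_right h3.diffFieldAt h1.mdifferentiableAt h2.diffFieldAt

lemma IsTensor.covDeriv_add_zero (hW : ∀ i, SmoothNear (W i) x) (hX : SmoothNear X x)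
    (hY : SmoothNear Y x) :
    covDeriv T (Fin.cons (X + Y) W) x
      = covDeriv T (Fin.cons X W) x + covDeriv T (Fin.cons Y W) x := by
  simp only [covDeriv, Fin.cons_zero, Fin.tail_cons, Pi.sub_apply, Finset.sum_apply]
  rw [nabla_add_left hX.diffFieldAt hY.diffFieldAt (hT.smooth hW).diffFieldAt,
    Finset.sum_congr rfl fun i _ ↦ hT.update_nabla_add_left hW i hX hY (hW i),
    Finset.sum_add_distrib]
  abel

lemma IsTensor.covDeriv_smul_zero (hW : ∀ i, SmoothNear (W i) x) (hf : SmoothFunNear n f x)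
    (hX : SmoothNear X x) :
    covDeriv T (Fin.cons (f • X) W) x = f x • covDeriv T (Fin.cons X W) x := by
  simp only [covDeriv, Fin.cons_zero, Fin.tail_cons, Pi.sub_apply, Finset.sum_apply]
  rw [nabla_smul_left hf.mdifferentiableAt hX.diffFieldAt (hT.smooth hW).diffFieldAt,
    Finset.sum_congr rfl fun i _ ↦ hT.update_nabla_smul_left hW i hf hX (hW i),
    ← Finset.smul_sum, smul_sub]

lemma IsTensor.covDeriv_add_succ (hW : ∀ i, SmoothNear (W i) x) (k : Fin m) (hX : SmoothNear X x)
    (hY : SmoothNear Y x) (hZ : SmoothNear Z x) :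
    covDeriv T (Fin.cons Z (Function.update W k (X + Y))) x
      = covDeriv T (Fin.cons Z (Function.update W k X)) x
        + covDeriv T (Fin.cons Z (Function.update W k Y)) x := by
  simp only [covDeriv, Fin.cons_zero, Fin.tail_cons, Pi.sub_apply, Finset.sum_apply]
  have h1 : ∀ᶠ y in 𝓝 x, T (Function.update W k (X + Y)) y
      = (T (Function.update W k X) + T (Function.update W k Y)) y := by
    filter_upwards [hX.eventually, hY.eventually,
      eventually_all.2 fun i ↦ (hW i).eventually] with y h1 h2 h3 using hT.add k h3 h1 h2
  have h2 : ∀ i, T (Function.update (Function.update W k (X + Y)) i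
        (nabla Z (Function.update W k (X + Y) i))) x
      = T (Function.update (Function.update W k X) i (nabla Z (Function.update W k X i))) x
        + T (Function.update (Function.update W k Y) i (nabla Z (Function.update W k Y i))) x := by
    intro i
    rcases eq_or_ne i k with rfl | hi
    · simp only [Function.update_self, Function.update_idem]
      exact hT.update_nabla_add_right hW i hX hY hZ
    · simp only [Function.update_of_ne hi, Function.update_comm hi.symm]
      exact hT.add k (smoothNear_update hW i (hZ.nabla (hW i))) hX hY
  rw [nabla_congr_right h1, nabla_add_right hZ.diffFieldAt (hT.smooth_update hW k hX).diffFieldAt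
    (hT.smooth_update hW k hY).diffFieldAt, Finset.sum_congr rfl fun i _ ↦ h2 i,
    Finset.sum_add_distrib]
  abel

/-- Differentiating `f • T(…)` yields a term in `Z f`. The correction term of slot `k` yields the
same one by the Leibniz rule, and they cancel. -/
lemma IsTensor.covDeriv_smul_succ (hW : ∀ i, SmoothNear (W i) x) (k : Fin m)
    (hf : SmoothFunNear n f x) (hX : SmoothNear X x) (hZ : SmoothNear Z x) :
    covDeriv T (Fin.cons Z (Function.update W k (f • X))) x
      = f x • covDeriv T (Fin.cons Z (Function.update W k X)) x := by
  simp only [covDeriv, Fin.cons_zero, Fin.tail_cons, Pi.sub_apply, Finset.sum_apply]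
  have h1 : ∀ᶠ y in 𝓝 x, T (Function.update W k (f • X)) y
      = (f • T (Function.update W k X)) y := by
    filter_upwards [hf.eventually, hX.eventually,
      eventually_all.2 fun i ↦ (hW i).eventually] with y h1 h2 h3 using hT.smul k h3 h1 h2
  have h2 : ∀ i, T (Function.update (Function.update W k (f • X)) i
        (nabla Z (Function.update W k (f • X) i))) x
      = f x • T (Function.update (Function.update W k X) i (nabla Z (Function.update W k X i))) x
        + if i = k then derivAlong Z f x • T (Function.update W k X) x else 0 := by
    intro i
    rcases eq_or_ne i k with rfl | hi
    · simp only [Function.update_self, Function.update_idem, if_true]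
      exact hT.update_nabla_smul_right hW i hf hX hZ
    · simp only [Function.update_of_ne hi, Function.update_comm hi.symm, if_neg hi, add_zero]
      exact hT.smul k (smoothNear_update hW i (hZ.nabla (hW i))) hf hX
  rw [nabla_congr_right h1, nabla_smul_right hZ.diffFieldAt hf.mdifferentiableAt
    (hT.smooth_update hW k hX).diffFieldAt, Finset.sum_congr rfl fun i _ ↦ h2 i,
    Finset.sum_add_distrib, Finset.sum_ite_eq' Finset.univ k, ← Finset.smul_sum, smul_sub,
    if_pos (Finset.mem_univ k)]
  simp only [derivAlong]
  abel

/-- The covariant derivative of a tensor is a tensor. -/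
lemma IsTensor.covDeriv : IsTensor (covDeriv T) where
  congr {x V W} h := by
    have h' := fun i ↦ eventually_eventually_nhds.2 (h i)
    have ht : ∀ i, ∀ᶠ y in 𝓝 x, Fin.tail V i y = Fin.tail W i y := fun i ↦ h i.succ
    simp only [RiemannianGeometry.covDeriv, Pi.sub_apply, Finset.sum_apply]
    congr 1
    · refine nabla_congr (h 0) ?_
      filter_upwards [eventually_all.2 h'] with y hy using hT.congr fun i ↦ hy i.succ
    · refine Finset.sum_congr rfl fun i _ ↦ hT.congr fun j ↦ ?_
      rcases eq_or_ne j i with rfl | hj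
      · simp only [Function.update_self]
        filter_upwards [eventually_all.2 h'] with y hy using nabla_congr (hy 0) (hy j.succ)
      · simpa [hj] using ht j
  smooth {x V} hV := by
    have ht : ∀ i, SmoothNear (Fin.tail V i) x := fun i ↦ hV i.succ
    exact ((hV 0).nabla (hT.smooth ht)).sub <| SmoothNear.sum _ fun i _ ↦
      hT.smooth_update ht i ((hV 0).nabla (ht i))
  add {x V} i {X Y} hV hX hY := by
    rw [← Fin.cons_self_tail V]
    have ht : ∀ i, SmoothNear (Fin.tail V i) x := fun i ↦ hV i.succ
    refine Fin.cases ?_ (fun k ↦ ?_) i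
    · simp only [Fin.update_cons_zero]
      exact hT.covDeriv_add_zero ht hX hY
    · simp only [← Fin.cons_update]
      exact hT.covDeriv_add_succ ht k hX hY (hV 0)
  smul {x V} i {f X} hV hf hX := by
    rw [← Fin.cons_self_tail V]
    have ht : ∀ i, SmoothNear (Fin.tail V i) x := fun i ↦ hV i.succ
    refine Fin.cases ?_ (fun k ↦ ?_) i
    · simp only [Fin.update_cons_zero]
      exact hT.covDeriv_smul_zero ht hf hX
    · simp only [← Fin.cons_update]
      exact hT.covDeriv_smul_succ ht k hf hX (hV 0)

end covDeriv

end Tensor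

/-! ### Hilbert-Schmidt norms of multilinear maps -/

section HilbertSchmidt

variable {V W : Type*} [NormedAddCommGroup V] [InnerProductSpace ℝ V] [NormedAddCommGroup W]
  [InnerProductSpace ℝ W] {ι κ : Type*} [Fintype ι] [Fintype κ] {m : ℕ}

/-- The squared Hilbert-Schmidt norm of a multilinear map with respect to an orthonormal basis. -/
def hsNormSq (A : MultilinearMap ℝ (fun _ : Fin m ↦ V) W) (b : OrthonormalBasis ι ℝ V) : ℝ :=
  ∑ s : Fin m → ι, ‖A fun i ↦ b (s i)‖ ^ 2

lemma multilinear_expand (A : MultilinearMap ℝ (fun _ : Fin m ↦ V) W) (b : OrthonormalBasis ι ℝ V)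
    (u : Fin m → V) :
    A u = ∑ s : Fin m → ι, (∏ i, inner ℝ (b (s i)) (u i)) • A fun i ↦ b (s i) := by
  classical
  have h : u = fun i ↦ ∑ a, inner ℝ (b a) (u i) • b a := by
    ext1 i; exact (b.sum_repr' (u i)).symm
  conv_lhs => rw [h]
  rw [MultilinearMap.map_sum]
  exact Finset.sum_congr rfl fun s _ ↦ A.map_smul_univ _ _

/-- Expanding `b'` in `b`, the sum over `r` of the products of coefficients factors slot by slot,
and each factor is a Parseval sum equal to a Kronecker delta. -/
lemma hsNormSq_eq (A : MultilinearMap ℝ (fun _ : Fin m ↦ V) W) (b : OrthonormalBasis ι ℝ V)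
    (b' : OrthonormalBasis κ ℝ V) : hsNormSq A b' = hsNormSq A b := by
  classical
  have key : ∀ s t : Fin m → ι, ∑ r : Fin m → κ,
      (∏ i, inner ℝ (b (s i)) (b' (r i))) * (∏ i, inner ℝ (b (t i)) (b' (r i)))
        = if s = t then (1 : ℝ) else 0 := by
    intro s t
    simp only [← Finset.prod_mul_distrib]
    rw [← Fintype.piFinset_univ, ← Finset.prod_univ_sum (fun _ ↦ Finset.univ)
      (fun i a ↦ inner ℝ (b (s i)) (b' a) * inner ℝ (b (t i)) (b' a))]
    have h1 : ∀ i, ∑ a, inner ℝ (b (s i)) (b' a) * inner ℝ (b (t i)) (b' a)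
        = if s i = t i then (1 : ℝ) else 0 := fun i ↦ by
      have := b'.sum_inner_mul_inner (b (s i)) (b (t i))
      rw [← (orthonormal_iff_ite.1 b.orthonormal) (s i) (t i), ← this]
      exact Finset.sum_congr rfl fun a _ ↦ by rw [real_inner_comm (b' a) (b (t i))]
    simp only [h1]
    by_cases hst : s = t
    · simp [hst]
    · obtain ⟨i, hi⟩ := Function.ne_iff.1 hst
      rw [if_neg hst]
      exact Finset.prod_eq_zero (Finset.mem_univ i) (if_neg hi)
  calc hsNormSq A b'
      = ∑ r : Fin m → κ, ∑ s : Fin m → ι, ∑ t : Fin m → ι,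
          ((∏ i, inner ℝ (b (s i)) (b' (r i))) * (∏ i, inner ℝ (b (t i)) (b' (r i)))) *
            inner ℝ (A fun i ↦ b (s i)) (A fun i ↦ b (t i)) := by
        refine Finset.sum_congr rfl fun r _ ↦ ?_
        rw [← real_inner_self_eq_norm_sq, multilinear_expand A b fun i ↦ b' (r i), sum_inner]
        refine Finset.sum_congr rfl fun s _ ↦ ?_
        rw [inner_sum]
        refine Finset.sum_congr rfl fun t _ ↦ ?_
        rw [real_inner_smul_left, real_inner_smul_right, mul_assoc]
    _ = ∑ s : Fin m → ι, ∑ t : Fin m → ι, (if s = t then (1 : ℝ) else 0) *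
            inner ℝ (A fun i ↦ b (s i)) (A fun i ↦ b (t i)) := by
        rw [Finset.sum_comm]
        refine Finset.sum_congr rfl fun s _ ↦ ?_
        rw [Finset.sum_comm]
        refine Finset.sum_congr rfl fun t _ ↦ ?_
        rw [← Finset.sum_mul, key]
    _ = hsNormSq A b := by
        refine Finset.sum_congr rfl fun s _ ↦ ?_
        simp

lemma eq_zero_of_hsNormSq_eq_zero {A : MultilinearMap ℝ (fun _ : Fin m ↦ V) W}
    {b : OrthonormalBasis ι ℝ V} (h : hsNormSq A b = 0) (u : Fin m → V) : A u = 0 := by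
  rw [multilinear_expand A b u]
  refine Finset.sum_eq_zero fun s hs ↦ ?_
  have := (Finset.sum_eq_zero_iff_of_nonneg fun _ _ ↦ sq_nonneg _).1 h s hs
  rw [norm_eq_zero.1 (pow_eq_zero_iff two_ne_zero |>.1 this), smul_zero]

/-- Cauchy-Schwarz for the expansion of `v` in the basis; with `B = ∇T` it bounds `|∇_v T|` by `‖v‖
|∇T|`. -/
lemma sum_norm_sq_cons_le (B : MultilinearMap ℝ (fun _ : Fin (m + 1) ↦ V) W)
    (b : OrthonormalBasis ι ℝ V) (v : V) :
    ∑ s : Fin m → ι, ‖B (Fin.cons v fun i ↦ b (s i))‖ ^ 2 ≤ ‖v‖ ^ 2 * hsNormSq B b := by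
  have h1 : hsNormSq B b
      = ∑ s : Fin m → ι, ∑ a, ‖B (Fin.cons (b a) fun i ↦ b (s i))‖ ^ 2 := by
    rw [hsNormSq, ← (Fin.consEquiv fun _ : Fin (m + 1) ↦ ι).sum_comp, Fintype.sum_prod_type,
      Finset.sum_comm]
    refine Finset.sum_congr rfl fun s _ ↦ Finset.sum_congr rfl fun a _ ↦ ?_
    congr 3
    ext1 i
    refine Fin.cases ?_ (fun j ↦ ?_) i <;> simp [Fin.consEquiv]
  rw [h1, Finset.mul_sum]
  refine Finset.sum_le_sum fun s _ ↦ ?_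
  have h2 : B (Fin.cons v fun i ↦ b (s i))
      = ∑ a, inner ℝ (b a) v • B (Fin.cons (b a) fun i ↦ b (s i)) := by
    have := congrArg (fun w ↦ B.curryLeft w fun i ↦ b (s i)) (b.sum_repr' v)
    simp only [map_sum, map_smul, sum_apply, smul_apply,
      MultilinearMap.curryLeft_apply] at this
    exact this.symm
  have h3 : ‖v‖ ^ 2 = ∑ a, |inner ℝ (b a) v| ^ 2 := by
    rw [← b.sum_sq_norm_inner_right v]; rfl
  calc ‖B (Fin.cons v fun i ↦ b (s i))‖ ^ 2
      ≤ (∑ a, |inner ℝ (b a) v| * ‖B (Fin.cons (b a) fun i ↦ b (s i))‖) ^ 2 := by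
        gcongr
        rw [h2]
        refine (norm_sum_le _ _).trans (Finset.sum_le_sum fun a _ ↦ ?_)
        rw [norm_smul, Real.norm_eq_abs]
    _ ≤ _ := by
        rw [h3]
        exact Finset.sum_mul_sq_le_sq_mul_sq _ _ _

/-- A skew-symmetric matrix acts on tensors by a derivation that is orthogonal to the identity. -/
lemma sum_skew_eq_zero [DecidableEq ι] (w : ι → ι → ℝ) (hw : ∀ a c, w a c = -w c a)
    (a : (Fin m → ι) → W) (i : Fin m) :
    ∑ s : Fin m → ι, ∑ c, w (s i) c * inner ℝ (a (Function.update s i c)) (a s) = 0 := by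
  -- The involution exchanges the index `s i` with the free index `c`. It negates the summand, by
  -- skewness of `w` and symmetry of the inner product, so the sum equals its own negative.
  let σ : Equiv.Perm ((Fin m → ι) × ι) :=
    { toFun p := (Function.update p.1 i p.2, p.1 i)
      invFun p := (Function.update p.1 i p.2, p.1 i)
      left_inv p := by simp
      right_inv p := by simp }
  rw [← Fintype.sum_prod_type']
  have h := Equiv.sum_comp σ fun p : (Fin m → ι) × ι ↦
    w (p.1 i) p.2 * inner ℝ (a (Function.update p.1 i p.2)) (a p.1)
  have h2 : ∀ p, (fun p : (Fin m → ι) × ι ↦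
      w (p.1 i) p.2 * inner ℝ (a (Function.update p.1 i p.2)) (a p.1)) (σ p)
      = -(w (p.1 i) p.2 * inner ℝ (a (Function.update p.1 i p.2)) (a p.1)) := fun p ↦ by
    simp only [σ, Equiv.coe_fn_mk, Function.update_self, Function.update_idem,
      Function.update_eq_self]
    rw [hw, real_inner_comm]
    ring
  rw [Finset.sum_congr rfl fun p _ ↦ h2 p, Finset.sum_neg_distrib] at h
  linarith

end HilbertSchmidt

/-! ### Pointwise values and norms of tensors, and Kato's inequality -/

section Pointwise

variable {n : ℕ} {M : Type*} [TopologicalSpace M]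
  [ChartedSpace (EuclideanSpace ℝ (Fin n)) M] [IsManifold (𝓡 n) ∞ M]
  [RiemannianBundle (fun x : M ↦ TangentSpace (𝓡 n) x)]
  [IsContMDiffRiemannianBundle (𝓡 n) ∞ (EuclideanSpace ℝ (Fin n))
    (fun x : M ↦ TangentSpace (𝓡 n) x)]
  {X Y : VField n M} {x : M} {m : ℕ} {T : (Fin m → VField n M) → VField n M}
  (hT : IsTensor T) {V W : Fin m → VField n M}

include hT

lemma IsTensor.update_zero (hV : ∀ i, SmoothNear (V i) x) (i : Fin m) :
    T (Function.update V i 0) x = 0 := by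
  have h : (fun _ : M ↦ (0 : ℝ)) • extendVec (0 : TangentSpace (𝓡 n) x) = 0 := by
    ext1 y
    simp
  have := hT.smul i hV (smoothFunNear_const 0) (smoothNear_extendVec (0 : TangentSpace (𝓡 n) x))
  rwa [h, zero_smul] at this

lemma IsTensor.update_sum (hV : ∀ i, SmoothNear (V i) x) (i : Fin m) {ι : Type*} (s : Finset ι)
    {X : ι → VField n M} (hX : ∀ a ∈ s, SmoothNear (X a) x) :
    T (Function.update V i (∑ a ∈ s, X a)) x = ∑ a ∈ s, T (Function.update V i (X a)) x := by
  classical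
  induction s using Finset.induction_on with
  | empty => simpa using hT.update_zero hV i
  | insert a s ha ih =>
    have hs : ∀ a ∈ s, SmoothNear (X a) x := fun b hb ↦ hX b (by simp [hb])
    rw [Finset.sum_insert ha, Finset.sum_insert ha, hT.add i hV (hX a (by simp))
      (SmoothNear.sum _ hs), ih hs]

/-- Near `x` the field is a combination of the frame with smooth coefficients, so locality and
linearity over functions apply; afterwards only the value `X x` remains. -/
lemma IsTensor.update_eq_sum (hV : ∀ i, SmoothNear (V i) x) (i : Fin m) (hX : SmoothNear X x)
    {ι : Type*} [Fintype ι] {E : ι → VField n M} (hE : IsOrthoFrameNear E x) :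
    T (Function.update V i X) x
      = ∑ a, inner ℝ (E a x) (X x) • T (Function.update V i (E a)) x := by
  have h : ∀ᶠ y in 𝓝 x, X y = (∑ a, innerField (E a) X • E a) y := by
    filter_upwards [hE.basis] with y ⟨b, hb⟩
    simp only [Finset.sum_apply, Pi.smul_apply', innerField_apply, hb]
    exact (b.sum_repr' _).symm
  rw [hT.update_congr i h, hT.update_sum hV i _ fun a _ ↦
    SmoothNear.smul ((hE.smooth a).innerField hX) (hE.smooth a)]
  exact Finset.sum_congr rfl fun a _ ↦
    hT.smul i hV ((hE.smooth a).innerField hX) (hE.smooth a)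

lemma IsTensor.update_eq_of_eq (hV : ∀ i, SmoothNear (V i) x) (i : Fin m) (hX : SmoothNear X x)
    (hY : SmoothNear Y x) (h : X x = Y x) :
    T (Function.update V i X) x = T (Function.update V i Y) x := by
  obtain ⟨E, hE, -⟩ := exists_isOrthoFrameNear (onb n x)
  rw [hT.update_eq_sum hV i hX hE, hT.update_eq_sum hV i hY hE, h]

/-- The value of a tensor at a point depends only on the values of its arguments there. -/
lemma IsTensor.eq_of_eq (hV : ∀ i, SmoothNear (V i) x) (hW : ∀ i, SmoothNear (W i) x)
    (h : ∀ i, V i x = W i x) : T V x = T W x := by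
  classical
  -- The arguments are exchanged one slot at a time, each exchange being `update_eq_of_eq`.
  have key : ∀ s : Finset (Fin m), T (s.piecewise W V) x = T V x := by
    intro s
    induction s using Finset.induction_on with
    | empty => simp
    | insert j s hj ih =>
      have hP : ∀ i, SmoothNear (s.piecewise W V i) x := fun i ↦ by
        by_cases hi : i ∈ s
        · simpa [hi] using hW i
        · simpa [hi] using hV i
      rw [Finset.piecewise_insert, hT.update_eq_of_eq hP j (hW j) (hV j) (h j).symm, ← ih]
      congr 1
      rw [Function.update_eq_iff]
      simp [hj]
  simpa using (key Finset.univ).symm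

lemma IsTensor.tensorAt_eq (hV : ∀ i, SmoothNear (V i) x) :
    tensorAt T x (fun i ↦ V i x) = T V x :=
  hT.eq_of_eq (fun i ↦ smoothNear_extendVec (V i x)) hV fun i ↦ by simp

lemma IsTensor.tensorAt_update {u : Fin m → TangentSpace (𝓡 n) x} {i : Fin m}
    {v : TangentSpace (𝓡 n) x} (hX : SmoothNear X x) (hv : X x = v) :
    tensorAt T x (Function.update u i v)
      = T (Function.update (fun j ↦ extendVec (u j)) i X) x := by
  rw [← hT.tensorAt_eq (smoothNear_update (fun j ↦ smoothNear_extendVec (u j)) i hX)]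
  congr 1
  ext1 j
  rcases eq_or_ne j i with rfl | h
  · simp [hv]
  · simp [h]

/-- The multilinear map on the tangent space at `x` that is given by a tensor. -/
def IsTensor.toMultilinear (x : M) :
    MultilinearMap ℝ (fun _ : Fin m ↦ TangentSpace (𝓡 n) x) (TangentSpace (𝓡 n) x) :=
  MultilinearMap.mk' (tensorAt T x)
    (fun u i v w ↦ by
      have hv := smoothNear_extendVec v
      have hw := smoothNear_extendVec w
      rw [hT.tensorAt_update hv (extendVec_self v), hT.tensorAt_update hw (extendVec_self w),
        hT.tensorAt_update (hv.add hw) (by simp),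
        hT.add i (fun j ↦ smoothNear_extendVec (u j)) hv hw])
    (fun u i c v ↦ by
      have hv := smoothNear_extendVec v
      have hc := smoothFunNear_const (n := n) (x := x) c
      rw [hT.tensorAt_update hv (extendVec_self v),
        hT.tensorAt_update (SmoothNear.smul hc hv) (by simp),
        hT.smul i (fun j ↦ smoothNear_extendVec (u j)) hc hv])

lemma IsTensor.toMultilinear_eq (hV : ∀ i, SmoothNear (V i) x) :
    hT.toMultilinear x (fun i ↦ V i x) = T V x := hT.tensorAt_eq hV

lemma IsTensor.tensorNorm_sq {ι : Type*} [Fintype ι]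
    (b : OrthonormalBasis ι ℝ (TangentSpace (𝓡 n) x)) :
    tensorNorm T x ^ 2 = hsNormSq (hT.toMultilinear x) b := by
  rw [tensorNorm, Real.sq_sqrt (Finset.sum_nonneg fun _ _ ↦ sq_nonneg _), ← hsNormSq_eq _ b (onb n x)]
  rfl

lemma IsTensor.tensorAt_eq_zero (h : tensorNorm T x = 0) (u : Fin m → TangentSpace (𝓡 n) x) :
    tensorAt T x u = 0 :=
  eq_zero_of_hsNormSq_eq_zero (A := hT.toMultilinear x) (b := onb n x)
    (by rw [← hT.tensorNorm_sq, h]; simp) u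

/-- Basis independence replaces the pointwise choice `onb` by a smooth frame; this makes `|T|²`
smooth and differentiable term by term. -/
lemma IsTensor.tensorNorm_sq_eq {ι : Type*} [Fintype ι] {E : ι → VField n M}
    (hE : IsOrthoFrameNear E x) :
    tensorNorm T x ^ 2 = ∑ s : Fin m → ι,
      innerField (T fun i ↦ E (s i)) (T fun i ↦ E (s i)) x := by
  obtain ⟨b, hb⟩ := hE.self
  rw [hT.tensorNorm_sq b, hsNormSq]
  refine Finset.sum_congr rfl fun s _ ↦ ?_
  rw [innerField_apply, real_inner_self_eq_norm_sq, ← hT.toMultilinear_eq fun i ↦ hE.smooth (s i)]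
  simp only [hb]

lemma IsTensor.smooth_tensorNorm_sq (x : M) :
    SmoothFunNear n (fun y ↦ tensorNorm T y ^ 2) x := by
  obtain ⟨E, hE, -⟩ := exists_isOrthoFrameNear (onb n x)
  refine SmoothFunNear.congr (SmoothFunNear.sum Finset.univ
    (f := fun s : Fin m → _ ↦ innerField (T fun i ↦ E (s i)) (T fun i ↦ E (s i))) fun s _ ↦ ?_) ?_
  · have := hT.smooth fun i ↦ hE.smooth (s i)
    exact this.innerField this
  · filter_upwards [hE.eventually] with y hy using hT.tensorNorm_sq_eq hy

omit hT in
lemma mvfderiv_sum {ι : Type*} (s : Finset ι) {f : ι → M → ℝ}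
    (hf : ∀ i ∈ s, SmoothFunNear n (f i) x) (v : TangentSpace (𝓡 n) x) :
    mvfderiv (𝓡 n) (fun y ↦ ∑ i ∈ s, f i y) x v = ∑ i ∈ s, mvfderiv (𝓡 n) (f i) x v := by
  classical
  induction s using Finset.induction_on with
  | empty => simp [mvfderiv_const]
  | insert a s ha ih =>
    have hs : ∀ a ∈ s, SmoothFunNear n (f a) x := fun b hb ↦ hf b (by simp [hb])
    simp only [Finset.sum_insert ha]
    rw [← ih hs]
    exact mvfderiv_add_apply (hf a (by simp)).mdifferentiableAt
      (SmoothFunNear.sum s hs).mdifferentiableAt v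

/-- The derivative of `|T|²` is `2 ⟨∇T, T⟩`, computed in an orthonormal frame. -/
lemma IsTensor.mvfderiv_tensorNorm_sq {ι : Type*} [Fintype ι] {E : ι → VField n M}
    (hE : IsOrthoFrameNear E x) (hX : SmoothNear X x) :
    mvfderiv (𝓡 n) (fun y ↦ tensorNorm T y ^ 2) x (X x)
      = 2 * ∑ s : Fin m → ι,
        inner ℝ (RiemannianGeometry.covDeriv T (Fin.cons X fun i ↦ E (s i)) x)
          (T (fun i ↦ E (s i)) x) := by
  classical
  obtain ⟨b, hb⟩ := hE.self
  have hTE : ∀ s : Fin m → ι, SmoothNear (T fun i ↦ E (s i)) x :=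
    fun s ↦ hT.smooth fun i ↦ hE.smooth (s i)
  set w : ι → ι → ℝ := fun a c ↦ inner ℝ (E c x) (nabla X (E a) x) with hw
  -- The functions `g(E_a, E_c)` are constant near `x`; metric compatibility turns their zero
  -- derivative into skewness of the connection coefficients.
  have hskew : ∀ a c, w a c = -w c a := fun a c ↦ by
    have h1 := mvfderiv_innerField hX.diffFieldAt (hE.smooth a).diffFieldAt
      (hE.smooth c).diffFieldAt
    have h2 : ∀ᶠ y in 𝓝 x, innerField (E a) (E c) y = if a = c then 1 else 0 := by
      filter_upwards [hE.basis] with y ⟨b, hb⟩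
      rw [innerField_apply, hb, hb]
      exact orthonormal_iff_ite.1 b.orthonormal a c
    rw [mvfderiv_congr h2, mvfderiv_const] at h1
    simp only [hw]
    rw [real_inner_comm] at h1
    have h1' : (0 : ℝ) = _ := h1
    linarith
  have hsplit : ∀ s : Fin m → ι, nabla X (T fun i ↦ E (s i)) x
      = RiemannianGeometry.covDeriv T (Fin.cons X fun i ↦ E (s i)) x
        + ∑ i, ∑ c, w (s i) c • T (fun j ↦ E (Function.update s i c j)) x := by
    intro s
    have h1 : ∀ i, T (Function.update (fun i ↦ E (s i)) i (nabla X (E (s i)))) x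
        = ∑ c, w (s i) c • T (fun j ↦ E (Function.update s i c j)) x := fun i ↦ by
      rw [hT.update_eq_sum (fun i ↦ hE.smooth (s i)) i (hX.nabla (hE.smooth (s i))) hE]
      refine Finset.sum_congr rfl fun c _ ↦ ?_
      congr 2
      ext1 j
      rcases eq_or_ne j i with rfl | h
      · simp
      · simp [h]
    simp only [RiemannianGeometry.covDeriv, Fin.cons_zero, Fin.tail_cons, Pi.sub_apply,
      Finset.sum_apply, h1, sub_add_cancel]
  have hF : ∀ᶠ y in 𝓝 x, tensorNorm T y ^ 2 = ∑ s : Fin m → ι,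
      innerField (T fun i ↦ E (s i)) (T fun i ↦ E (s i)) y := by
    filter_upwards [hE.eventually] with y hy using hT.tensorNorm_sq_eq hy
  -- The frame need not be parallel at `x`: the total contribution of the connection coefficients to
  -- `d|T|²` vanishes by skewness.
  have hzero : ∑ s : Fin m → ι, ∑ i, ∑ c, w (s i) c *
      inner ℝ (T (fun j ↦ E (Function.update s i c j)) x) (T (fun j ↦ E (s j)) x) = 0 := by
    rw [Finset.sum_comm]
    exact Finset.sum_eq_zero fun i _ ↦
      sum_skew_eq_zero w hskew (fun s ↦ T (fun j ↦ E (s j)) x) i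
  rw [mvfderiv_congr hF, mvfderiv_sum _ fun s _ ↦ (hTE s).innerField (hTE s)]
  have h3 : ∀ s : Fin m → ι, mvfderiv (𝓡 n)
      (innerField (T fun i ↦ E (s i)) (T fun i ↦ E (s i))) x (X x)
      = 2 * (inner ℝ (RiemannianGeometry.covDeriv T (Fin.cons X fun i ↦ E (s i)) x)
          (T (fun i ↦ E (s i)) x) + ∑ i, ∑ c, w (s i) c *
            inner ℝ (T (fun j ↦ E (Function.update s i c j)) x) (T (fun j ↦ E (s j)) x)) := by
    intro s
    rw [mvfderiv_innerField hX.diffFieldAt (hTE s).diffFieldAt (hTE s).diffFieldAt,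
      real_inner_comm (nabla X (T fun i ↦ E (s i)) x), ← two_mul, hsplit, inner_add_left]
    simp only [sum_inner, real_inner_smul_left]
  rw [Finset.sum_congr rfl fun s _ ↦ h3 s, ← Finset.mul_sum, Finset.sum_add_distrib, hzero,
    add_zero]

/-- Kato's inequality `|d|T|²| ≤ 2 |T| |∇T|`. -/
lemma IsTensor.abs_mvfderiv_tensorNorm_sq_le (v : TangentSpace (𝓡 n) x) :
    |mvfderiv (𝓡 n) (fun y ↦ tensorNorm T y ^ 2) x v|
      ≤ 2 * tensorNorm T x * tensorNorm (RiemannianGeometry.covDeriv T) x * ‖v‖ := by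
  obtain ⟨E, hE, hb⟩ := exists_isOrthoFrameNear (onb n x)
  set b := onb n x
  have hX := smoothNear_extendVec v
  have h := hT.mvfderiv_tensorNorm_sq hE hX
  rw [extendVec_self] at h
  have hD := hT.covDeriv
  have h1 : ∀ s : Fin m → _, RiemannianGeometry.covDeriv T (Fin.cons (extendVec v)
      fun i ↦ E (s i)) x = hD.toMultilinear x (Fin.cons v fun i ↦ b (s i)) := fun s ↦ by
    rw [← hD.toMultilinear_eq]
    · congr 1
      ext1 i
      refine Fin.cases ?_ (fun j ↦ ?_) i <;> simp [hb]
    · exact fun i ↦ Fin.cases hX (fun j ↦ hE.smooth (s j)) i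
  have h2 : ∀ s : Fin m → _, T (fun i ↦ E (s i)) x = hT.toMultilinear x fun i ↦ b (s i) :=
    fun s ↦ by
      rw [← hT.toMultilinear_eq fun i ↦ hE.smooth (s i)]
      simp only [hb]
  have hn : ∀ {k : ℕ} (S : (Fin k → VField n M) → VField n M), 0 ≤ tensorNorm S x :=
    fun S ↦ Real.sqrt_nonneg _
  have hN1 := sum_norm_sq_cons_le (hD.toMultilinear x) b v
  rw [← hD.tensorNorm_sq, ← mul_pow] at hN1
  have hN2 : ∑ s : Fin m → _, ‖hT.toMultilinear x fun i ↦ b (s i)‖ ^ 2 = tensorNorm T x ^ 2 :=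
    (hT.tensorNorm_sq b).symm
  rw [h, abs_mul, abs_two]
  calc 2 * |∑ s : Fin m → _, inner ℝ (RiemannianGeometry.covDeriv T (Fin.cons (extendVec v)
          fun i ↦ E (s i)) x) (T (fun i ↦ E (s i)) x)|
      ≤ 2 * ∑ s : Fin m → _, ‖hD.toMultilinear x (Fin.cons v fun i ↦ b (s i))‖
          * ‖hT.toMultilinear x fun i ↦ b (s i)‖ := by
        gcongr
        refine (Finset.abs_sum_le_sum_abs _ _).trans (Finset.sum_le_sum fun s _ ↦ ?_)
        rw [h1, h2]
        exact abs_real_inner_le_norm _ _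
    _ ≤ 2 * (Real.sqrt (∑ s : Fin m → _, ‖hD.toMultilinear x (Fin.cons v fun i ↦ b (s i))‖ ^ 2)
          * Real.sqrt (∑ s : Fin m → _, ‖hT.toMultilinear x fun i ↦ b (s i)‖ ^ 2)) := by
        gcongr
        exact Real.sum_mul_le_sqrt_mul_sqrt _ _ _
    _ ≤ 2 * ((‖v‖ * tensorNorm (RiemannianGeometry.covDeriv T) x) * tensorNorm T x) := by
        rw [hN2, Real.sqrt_sq (hn T)]
        gcongr
        · exact hn T
        · exact Real.sqrt_le_iff.2 ⟨mul_nonneg (norm_nonneg _) (hn _), hN1⟩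
    _ = _ := by ring

end Pointwise

/-! ### Oscillation along paths and point picking -/

section Path

variable {n : ℕ} {M : Type*} [MetricSpace M]
  [ChartedSpace (EuclideanSpace ℝ (Fin n)) M] [IsManifold (𝓡 n) ∞ M]
  [RiemannianBundle (fun x : M ↦ TangentSpace (𝓡 n) x)]
  [IsRiemannianManifold (𝓡 n) M]

/-- A differential bound on a ball gives an oscillation bound on this ball. -/
lemma abs_sub_le_of_mvfderiv_le {F : M → ℝ} (hF : ∀ y, ContMDiffAt (𝓡 n) 𝓘(ℝ) 1 F y) {x y : M}
    {ρ C : ℝ} (hC : 0 ≤ C)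
    (hb : ∀ z ∈ Metric.ball x ρ, ∀ v : TangentSpace (𝓡 n) z, |mvfderiv (𝓡 n) F z v| ≤ C * ‖v‖)
    (hy : y ∈ Metric.ball x ρ) : |F y - F x| ≤ C * ρ := by
  have hρ : 0 < ρ := Metric.pos_of_mem_ball hy
  have hxy : riemannianEDist (𝓡 n) x y < ENNReal.ofReal ρ := by
    rw [← IsRiemannianManifold.out, edist_dist, ENNReal.ofReal_lt_ofReal_iff hρ, dist_comm]
    exact hy
  obtain ⟨γ, h0, h1, hγ, hlen⟩ := exists_lt_of_riemannianEDist_lt hxy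
  -- Every initial segment of `γ` is shorter than `ρ`, so the path never leaves the ball on which
  -- the differential is bounded.
  have hmem : ∀ t ∈ Set.Icc (0 : ℝ) 1, γ t ∈ Metric.ball x ρ := fun t ht ↦ by
    have h2 : edist x (γ t) < ENNReal.ofReal ρ := by
      rw [IsRiemannianManifold.out (I := 𝓡 n)]
      refine lt_of_le_of_lt (riemannianEDist_le_pathELength
        (hγ.mono (Set.Icc_subset_Icc_right ht.2)) h0 rfl ht.1) ?_
      exact lt_of_le_of_lt (pathELength_mono le_rfl ht.2) hlen
    rw [edist_dist, ENNReal.ofReal_lt_ofReal_iff hρ, dist_comm] at h2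
    exact h2
  have hFγ : ContMDiffOn 𝓘(ℝ) 𝓘(ℝ) 1 (F ∘ γ) (Set.Icc 0 1) := fun t ht ↦
    (hF (γ t)).comp_contMDiffWithinAt t (hγ t ht)
  have h2 : edist (F x) (F y) ≤ pathELength 𝓘(ℝ) (F ∘ γ) 0 1 := by
    rw [IsRiemannianManifold.out (I := 𝓘(ℝ))]
    exact riemannianEDist_le_pathELength hFγ (by simp [h0]) (by simp [h1]) zero_le_one
  have h3 : pathELength 𝓘(ℝ) (F ∘ γ) 0 1 ≤ ENNReal.ofReal C * pathELength (𝓡 n) γ 0 1 := by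
    rw [pathELength_eq_lintegral_mfderivWithin_Icc, pathELength_eq_lintegral_mfderivWithin_Icc,
      ← lintegral_const_mul' _ _ ENNReal.ofReal_ne_top]
    refine setLIntegral_mono' measurableSet_Icc fun t ht ↦ ?_
    have hu : UniqueMDiffWithinAt 𝓘(ℝ) (Set.Icc (0 : ℝ) 1) t :=
      (uniqueDiffOn_Icc zero_lt_one t ht).uniqueMDiffWithinAt
    have h4 := mfderiv_comp_mfderivWithin t ((hF (γ t)).mdifferentiableAt one_ne_zero)
      ((hγ t ht).mdifferentiableWithinAt one_ne_zero) hu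
    have h5 := hb (γ t) (hmem t ht) (mfderivWithin 𝓘(ℝ) (𝓡 n) γ (Set.Icc 0 1) t 1)
    have h6 : ‖mfderivWithin 𝓘(ℝ) 𝓘(ℝ) (F ∘ γ) (Set.Icc 0 1) t 1‖ₑ
        = ‖mvfderiv (𝓡 n) F (γ t) (mfderivWithin 𝓘(ℝ) (𝓡 n) γ (Set.Icc 0 1) t 1)‖ₑ := by
      rw [enorm_tangentSpace_vectorSpace, h4]
      rfl
    rw [h6, ← ofReal_norm, ← ofReal_norm, ← ENNReal.ofReal_mul hC]
    exact ENNReal.ofReal_le_ofReal h5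
  have h6 : edist (F x) (F y) ≤ ENNReal.ofReal (C * ρ) := by
    rw [ENNReal.ofReal_mul hC]
    exact h2.trans (h3.trans (by gcongr))
  rw [edist_dist, ENNReal.ofReal_le_ofReal_iff (by positivity), dist_comm, Real.dist_eq] at h6
  exact h6

end Path

/-- Point picking: a continuous function on a complete metric space that is positive somewhere
is almost maximal at some point, at the scale of its value there. -/
lemma exists_almost_max {M : Type*} [MetricSpace M] [CompleteSpace M] {f : M → ℝ}
    (hf : Continuous f) {x₀ : M} (h₀ : 0 < f x₀) :
    ∃ x, 0 < f x ∧ ∀ y ∈ Metric.ball x (1 / √(f x)), f y ≤ 4 * f x := by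
  -- Otherwise every point with positive value has a point within `1 / √f` whose value is more than
  -- four times larger; iterate from `x₀`.
  by_contra! hcon
  choose g hg using fun x : {x // 0 < f x} ↦ hcon x x.2
  let G : {x // 0 < f x} → {x // 0 < f x} := fun x ↦
    ⟨g x, lt_trans (by linarith [x.2]) (hg x).2⟩
  let u : ℕ → {x // 0 < f x} := fun k ↦ G^[k] ⟨x₀, h₀⟩
  have hu : ∀ k, u (k + 1) = G (u k) := fun k ↦ Function.iterate_succ_apply' _ _ _
  have hgrow : ∀ k, 4 ^ k * f x₀ ≤ f (u k) := by
    intro k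
    induction k with
    | zero => simp [u]
    | succ k ih =>
      rw [hu, pow_succ]
      have := (hg (u k)).2
      change _ ≤ f (g (u k))
      linarith
  -- Growth of `f` by a factor `4` doubles `√f`, so the steps are bounded by a geometric series of
  -- ratio `1/2`. The iterates converge while `f` blows up along them, contradicting continuity.
  have hdist : ∀ k, dist (u k : M) (u (k + 1)) ≤ 1 / √(f x₀) * (1 / 2) ^ k := by
    intro k
    rw [hu, dist_comm]
    refine (Metric.mem_ball.1 (hg (u k)).1).le.trans ?_
    have h1 : 2 ^ k * √(f x₀) ≤ √(f (u k)) := by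
      refine Real.le_sqrt_of_sq_le ?_
      rw [mul_pow, Real.sq_sqrt h₀.le, ← pow_mul, mul_comm k, pow_mul]
      norm_num
      exact hgrow k
    have h2 : 0 < √(f x₀) := Real.sqrt_pos.2 h₀
    calc 1 / √(f (u k)) ≤ 1 / (2 ^ k * √(f x₀)) := by gcongr
      _ = _ := by rw [one_div_pow]; field_simp
  obtain ⟨z, hz⟩ := cauchySeq_tendsto_of_complete
    (cauchySeq_of_le_geometric (1 / 2) _ (by norm_num) hdist)
  have h1 : Tendsto (fun k ↦ f (u k)) atTop (𝓝 (f z)) := (hf.tendsto z).comp hz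
  have h2 : Tendsto (fun k ↦ f (u k)) atTop atTop :=
    tendsto_atTop_mono hgrow
      ((tendsto_pow_atTop_atTop_of_one_lt (by norm_num)).atTop_mul_const h₀)
  exact not_tendsto_nhds_of_tendsto_atTop h2 _ h1

/-! ### The lower curvature bound on a ball -/

section Gap

variable {n : ℕ} {M : Type*} [MetricSpace M]
  [ChartedSpace (EuclideanSpace ℝ (Fin n)) M] [IsManifold (𝓡 n) ∞ M]
  [RiemannianBundle (fun x : M ↦ TangentSpace (𝓡 n) x)]
  [IsContMDiffRiemannianBundle (𝓡 n) ∞ (EuclideanSpace ℝ (Fin n))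
    (fun x : M ↦ TangentSpace (𝓡 n) x)]

lemma tensorNorm_nonneg {m : ℕ} (T : (Fin m → VField n M) → VField n M) (x : M) :
    0 ≤ tensorNorm T x := Real.sqrt_nonneg _

lemma IsTensor.continuous_tensorNorm {m : ℕ} {T : (Fin m → VField n M) → VField n M}
    (hT : IsTensor T) : Continuous (tensorNorm T) := by
  have h : Continuous fun y ↦ tensorNorm T y ^ 2 := continuous_iff_continuousAt.2 fun y ↦
    (hT.smooth_tensorNorm_sq y).contMDiffAt.continuousAt
  refine (Real.continuous_sqrt.comp h).congr fun y ↦ ?_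
  exact Real.sqrt_sq (tensorNorm_nonneg T y)

/-- In a complete non-flat `(Λ, 1)`-regular manifold the curvature is bounded from below on some
ball whose radius is comparable to the curvature scale. -/
lemma exists_ball_curvature_ge [IsRiemannianManifold (𝓡 n) M] [CompleteSpace M] {L : ℝ}
    (hL : 1 ≤ L) (hreg : IsRegularMetric n M L 1) {x₀ : M}
    (h₀ : 0 < tensorNorm (n := n) (nablaRm 0) x₀) :
    ∃ x : M, ∃ s : ℝ, 0 < s ∧ ∀ y ∈ Metric.ball x (1 / (256 * L * s)),
      (s / 2) ^ 2 ≤ tensorNorm (n := n) (nablaRm 0) y := by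
  have hT : IsTensor (nablaRm 0 : (Fin 3 → VField n M) → VField n M) := isTensor_curvature
  set f : M → ℝ := fun y ↦ tensorNorm (n := n) (nablaRm 0) y with hf
  obtain ⟨x, hx, hmax⟩ := exists_almost_max hT.continuous_tensorNorm h₀
  set s := √(f x) with hs
  have hs0 : 0 < s := Real.sqrt_pos.2 hx
  have hfx : f x = s ^ 2 := (Real.sq_sqrt hx.le).symm
  have hmax' : ∀ y ∈ Metric.ball x (1 / s), f y ≤ 4 * s ^ 2 := fun y hy ↦
    (hmax y hy).trans_eq (by rw [← hfx])
  -- With `r = 1/(2s)` the required bound `1/r²` is exactly `4s²`, and the ball of radius `r/2 =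
  -- 1/(4s)` lies in the picked ball. The outcome is `|∇Rm| ≤ 16 L s³` on radius `1/(8s)`.
  have hr := hreg x (1 / (2 * s)) (1 / 2) (by positivity) (by norm_num) (by norm_num)
    (fun y hy ↦ by
      refine (hmax' y (Metric.ball_subset_ball ?_ hy)).trans_eq (by field_simp; norm_num)
      rw [div_mul_div_comm, one_mul]
      gcongr
      linarith) 1 le_rfl le_rfl
  -- The square is used because `|Rm|` itself may fail to be differentiable at its zeros. Here `128
  -- = 2 · 4 · 16`, from Kato's inequality and the two bounds.
  have hb : ∀ y ∈ Metric.ball x (1 / (256 * L * s)), ∀ v : TangentSpace (𝓡 n) y,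
      |mvfderiv (𝓡 n) (fun y ↦ f y ^ 2) y v| ≤ 128 * L * s ^ 5 * ‖v‖ := fun y hy v ↦ by
    refine (hT.abs_mvfderiv_tensorNorm_sq_le v).trans ?_
    have h1 : f y ≤ 4 * s ^ 2 := hmax' y (Metric.ball_subset_ball
      (one_div_le_one_div_of_le hs0 (by nlinarith)) hy)
    have h2 : tensorNorm (n := n) (nablaRm 1) y ≤ 16 * L * s ^ 3 := by
      refine (hr y (Metric.ball_subset_ball ?_ hy)).trans_eq (by field_simp; norm_num)
      rw [div_div, div_mul_div_comm, one_mul]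
      exact one_div_le_one_div_of_le (by positivity) (by nlinarith)
    have h3 := tensorNorm_nonneg (nablaRm 0 : (Fin 3 → VField n M) → VField n M) y
    have h4 := tensorNorm_nonneg (nablaRm 1 : (Fin 4 → VField n M) → VField n M) y
    calc 2 * f y * tensorNorm (n := n) (nablaRm 1) y * ‖v‖
        ≤ 2 * (4 * s ^ 2) * (16 * L * s ^ 3) * ‖v‖ := by gcongr
      _ = _ := by ring
  refine ⟨x, s, hs0, fun y hy ↦ ?_⟩
  have h1 := abs_sub_le_of_mvfderiv_le
    (fun y ↦ (hT.smooth_tensorNorm_sq y).contMDiffAt.of_le ENat.LEInfty.out)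
    (by positivity) hb hy
  -- The radius is chosen so that `|Rm|²` drops by at most half of its central value `s⁴`; the
  -- remaining `s⁴/2` exceeds `(s/2)⁴`.
  have h2 : 128 * L * s ^ 5 * (1 / (256 * L * s)) = s ^ 4 / 2 := by field_simp; norm_num
  rw [h2] at h1
  have h3 := (abs_le.1 h1).1
  change _ ≤ f y ^ 2 - f x ^ 2 at h3
  rw [hfx] at h3
  refine le_of_sq_le_sq ?_ (tensorNorm_nonneg _ y)
  change _ ≤ f y ^ 2
  nlinarith [pow_pos hs0 4]

end Gap

end RiemannianGeometry

end

theorem corollary3p4 (L : ℝ) (hL : 1 ≤ L) (n : ℕ) :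
    ∃ ε : ℝ, 0 < ε ∧
      ∀ (M : Type*) [MetricSpace M] [MeasurableSpace M] [BorelSpace M]
        [ChartedSpace (EuclideanSpace ℝ (Fin n)) M] [IsManifold (𝓡 n) ∞ M]
        [RiemannianBundle (fun x : M ↦ TangentSpace (𝓡 n) x)]
        [IsContMDiffRiemannianBundle (𝓡 n) ∞ (EuclideanSpace ℝ (Fin n))
          (fun x : M ↦ TangentSpace (𝓡 n) x)]
        [IsRiemannianManifold (𝓡 n) M] [CompleteSpace M],
        RiemannianGeometry.IsRegularMetric n M L 1 →
        ∀ v : ℝ, 0 < v →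
          (∀ (x : M) (r : ℝ), 0 < r →
            ENNReal.ofReal (v * r ^ n)
              ≤ RiemannianGeometry.riemannianVolume n M (Metric.ball x r)) →
          (∫⁻ y, ENNReal.ofReal
              (RiemannianGeometry.tensorNorm (n := n) (RiemannianGeometry.nablaRm 0) y
                ^ ((n : ℝ) / 2)) ∂(RiemannianGeometry.riemannianVolume n M)
            ≤ ENNReal.ofReal (ε * v)) →
          ∀ (x : M) (u : Fin 3 → TangentSpace (𝓡 n) x),
            RiemannianGeometry.tensorAt RiemannianGeometry.curvature x u = 0 := by
  -- `(1/(512 L))^n · v` is the energy that any nonzero curvature forces on some ball; half of it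
  -- makes the contradiction strict.
  refine ⟨(1 / (512 * L)) ^ n / 2, by positivity, ?_⟩
  intro M _ _ _ _ _ _ _ _ _ hreg v hv hvol hint x u
  refine RiemannianGeometry.isTensor_curvature.tensorAt_eq_zero ?_ u
  by_contra hne
  have h₀ : 0 < RiemannianGeometry.tensorNorm (n := n) (RiemannianGeometry.nablaRm 0) x :=
    lt_of_le_of_ne (RiemannianGeometry.tensorNorm_nonneg _ x) (Ne.symm hne)
  obtain ⟨z, s, hs, hball⟩ := RiemannianGeometry.exists_ball_curvature_ge hL hreg h₀
  have hρ : 0 < 1 / (256 * L * s) := by positivity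
  have h1 : ENNReal.ofReal ((s / 2) ^ n) * ENNReal.ofReal (v * (1 / (256 * L * s)) ^ n)
      ≤ ENNReal.ofReal ((1 / (512 * L)) ^ n / 2 * v) := by
    refine le_trans ?_ hint
    refine le_trans (mul_le_mul_right (hvol z _ hρ) _) ?_
    rw [← setLIntegral_const]
    refine le_trans (setLIntegral_mono' measurableSet_ball fun y hy ↦ ?_)
      (setLIntegral_le_lintegral _ _)
    refine ENNReal.ofReal_le_ofReal ?_
    -- The bound `|Rm| ≥ (s/2)²` is raised to the real power `n/2`, which returns the natural power
    -- `(s/2)^n`.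
    have h2 : (s / 2) ^ n = ((s / 2) ^ 2) ^ ((n : ℝ) / 2) := by
      rw [← Real.rpow_natCast, ← Real.rpow_natCast, ← Real.rpow_mul (by positivity)]
      congr 1
      push_cast
      ring
    rw [h2]
    exact Real.rpow_le_rpow (by positivity) (hball y hy) (by positivity)
  rw [← ENNReal.ofReal_mul (by positivity), ENNReal.ofReal_le_ofReal_iff (by positivity)] at h1
  have h3 : (s / 2) ^ n * (v * (1 / (256 * L * s)) ^ n) = (1 / (512 * L)) ^ n * v := by
    rw [mul_left_comm, ← mul_pow, mul_comm]
    congr 2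
    field_simp
    norm_num
  rw [h3] at h1
  have h4 : 0 < (1 / (512 * L)) ^ n * v := by positivity
  linarith
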